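/- Write $D=\mathrm{diag}(1,-1)$ and let $SU_{1,1}=\{A\in SL_2\mathbb C : D(\bar A^t)^{-1}D=A\}$. Let $(\Lambda SL_2\mathbb C)_\sigma$ be the group of smooth maps $\gamma:S^1\to SL_2\mathbb C$ with $D\gamma(-\lambda)D=\gamma(\lambda)$, let $(\Lambda SU_{1,1})_\sigma$ be the subgroup of those with values in $SU_{1,1}$, and let $(\Lambda_+SL_2\mathbb C)_\sigma$ be the subgroup of those that extend continuously to the closed unit disk, with values in $SL_2\mathbb C$, and holomorphically on its interior. For $z\in\mathbb C\setminus(-\infty,0]$ and $\lambda\in S^1$ let $$L(z,\lambda)=\begin{pmatrix}1&0\\ \tfrac1\lambda\log z&1\end{pmatrix}L_0(z,\lambda),\qquad L_0=\begin{pmatrix} f_0&\lambda z\frac{d}{dz}f_0\\ f_1& f_0+\lambda z\frac{d}{dz}f_1\end{pmatrix},$$ $$f_0=\sum_{i\ge0}\frac{z^i}{(i!)^2\lambda^{2i}},\qquad f_1=-\frac2\lambda\sum_{i\ge1}\Bigl(1+\cdots+\frac1i\Bigr)\frac{z^i}{(i!)^2\lambda^{2i}}$$ (principal logarithm). This is the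 canonical solution of $L^{-1}dL=\frac1\lambda\begin{pmatrix}0&1\\1/z&0\end{pmatrix}dz$ with $L_0(0,\lambda)=I$, the complex extended frame of the quantum cohomology of $\mathbb CP^1$. Let $w(\lambda)=\begin{pmatrix}0&\lambda\\-1/\lambda&0\end{pmatrix}$ and $d(\epsilon)=\mathrm{diag}(1,\epsilon)$. **Theorem.** For any $a>0$ consider the element $$\gamma_0(\lambda)=\begin{pmatrix}1/\sqrt a&-\lambda/\sqrt a\\0&\sqrt a\end{pmatrix}$$ of $(\Lambda SL_2\mathbb C)_\sigma$. There are an open neighbourhood $V$ of $0$ in $\mathbb C$ such that $U=V\cap(\mathbb C\setminus(-\infty,0])$ is connected, and maps $F:U\to(\Lambda SU_{1,1})_\sigma$ and $B:U\to(\Lambda_+SL_2\mathbb C)_\sigma$, both smooth in $(z,\lambda)\in U\times S^1$, such that the following hold. (a) $\gamma_0^{-1}L=F\,w\,B$ on $U$ (an Iwasawa factorization). (b) $B$ is homogeneous: $B(\epsilon^2z,\epsilon\lambda)=d(\epsilon)^{-1}B(z,\lambda)d(\epsilon)$ for all $\epsilon,\lambda\in S^1$ and all $z\in U$ with $\epsilon^2z\in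 U$. Consequently the $1$-form $\alpha=(Fw)^{-1}d(Fw)$ is homogeneous: for the same $\epsilon,\lambda,z$, $\alpha(\epsilon^2z,\epsilon\lambda)=d(\epsilon)^{-1}\alpha(z,\lambda)d(\epsilon)$, where $\alpha(\epsilon^2z,\epsilon\lambda)$ is understood as the pull-back of $\alpha(\cdot,\epsilon\lambda)$ under $z\mapsto\epsilon^2z$. (c) $B=\mathrm{diag}(k,k^{-1})+O(\lambda)$ as $\lambda\to0$, where $k=k(z)>0$ is equal to $\sqrt{-a-t-\bar t}$, $t=\log z$, times a function which tends to $1$ as $z\to0$ in $U$. -/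

import Mathlib

open scoped ContDiff Topology ComplexConjugate

namespace CP1

noncomputable section

/-- Complex `2 × 2` matrices. -/
abbrev Mat2 : Type := Matrix (Fin 2) (Fin 2) ℂ

/-- `D = diag(1, -1)`. -/
def D : Mat2 := !![1, 0; 0, -1]

/-- `SU_{1,1}`: the elements of `SL_2(ℂ)` fixed by `C(A) = D (Āᵗ)⁻¹ D`. -/
def SU11 : Set Mat2 := {A | A.det = 1 ∧ D * A.conjTranspose⁻¹ * D = A}

/-- `Λ SL_2(ℂ)`: smooth maps from the unit circle to `SL_2(ℂ)`.
Smoothness on the circle is smoothness in the angle. -/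
def LoopSL : Set (Circle → Mat2) :=
  {γ | (∀ i j, ContDiff ℝ ∞ (fun θ : ℝ => γ (Circle.exp θ) i j)) ∧ ∀ l, (γ l).det = 1}

/-- The twisting condition `D γ(-λ) D = γ(λ)`. -/
def IsTwisted (γ : Circle → Mat2) : Prop :=
  ∀ l m : Circle, (m : ℂ) = -(l : ℂ) → D * γ m * D = γ l

/-- `(Λ SL_2(ℂ))_σ`. -/
def TwistedLoopSL : Set (Circle → Mat2) := {γ | γ ∈ LoopSL ∧ IsTwisted γ}

/-- `(Λ SU_{1,1})_σ`. -/
def TwistedLoopSU11 : Set (Circle → Mat2) := {γ | γ ∈ TwistedLoopSL ∧ ∀ l, γ l ∈ SU11}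

/-- `G` is an extension of the loop `γ` to the closed unit disk with values in `SL_2(ℂ)`,
holomorphic in the interior. (It is unique on the closed disk if it exists.) -/
structure IsDiskExtension (γ : Circle → Mat2) (G : ℂ → Mat2) : Prop where
  continuousOn : ∀ i j, ContinuousOn (fun l => G l i j) (Metric.closedBall 0 1)
  differentiableOn : ∀ i j, DifferentiableOn ℂ (fun l => G l i j) (Metric.ball 0 1)
  det_eq_one : ∀ l ∈ Metric.closedBall (0 : ℂ) 1, (G l).det = 1
  eq_on_circle : ∀ l : Circle, G l = γ l

/-- `(Λ₊ SL_2(ℂ))_σ`. -/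
def TwistedLoopPlus : Set (Circle → Mat2) := {γ | γ ∈ TwistedLoopSL ∧ ∃ G, IsDiskExtension γ G}

/-- `γ = A + O(λ)` for a loop `γ` that extends holomorphically to the unit disk. -/
def HasLeadingTerm (γ : Circle → Mat2) (A : Mat2) : Prop :=
  ∃ G, IsDiskExtension γ G ∧
    ∀ i j, (fun l : ℂ => G l i j - A i j) =O[𝓝 0] (fun l : ℂ => l)

/-- The family of loops `(z, λ) ↦ G z λ` is smooth on `U × S¹`. -/
def IsSmoothFamily (U : Set ℂ) (G : ℂ → Circle → Mat2) : Prop :=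
  ∀ i j, ContDiffOn ℝ ∞ (fun p : ℂ × ℝ => G p.1 (Circle.exp p.2) i j) (U ×ˢ Set.univ)

/-- `Φ = F w B` on `U` is an Iwasawa factorization: `F` and `B` are smooth maps on `U` with values
in `(Λ SU_{1,1})_σ` and `(Λ₊ SL_2(ℂ))_σ` respectively. -/
structure IsIwasawaFactorization (U : Set ℂ) (Φ F : ℂ → Circle → Mat2) (w : Circle → Mat2)
    (B : ℂ → Circle → Mat2) : Prop where
  smooth_left : IsSmoothFamily U F
  smooth_right : IsSmoothFamily U B
  left_mem : ∀ z ∈ U, F z ∈ TwistedLoopSU11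
  right_mem : ∀ z ∈ U, B z ∈ TwistedLoopPlus
  eq_mul : ∀ z ∈ U, ∀ l, Φ z l = F z l * w l * B z l

/-- The value at the tangent vector `v` at `z` of the matrix-valued `1`-form `G⁻¹ dG`
(`d` is the real exterior derivative in `z`), for the parameter `λ`. -/
def maurerCartan (G : ℂ → Circle → Mat2) (z : ℂ) (l : Circle) (v : ℂ) : Mat2 :=
  (G z l)⁻¹ * Matrix.of fun i j => fderiv ℝ (fun x : ℂ => G x l i j) z v

/-- `d(ε) = diag(1, ε)`. -/
def dEps (ε : Circle) : Mat2 := !![1, 0; 0, (ε : ℂ)]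

/-- The representative `w` of the second open Iwasawa orbit. -/
def w (l : Circle) : Mat2 := !![0, (l : ℂ); -(l : ℂ)⁻¹, 0]

/-- `f₀(z) = ∑_{i ≥ 0} zⁱ / ((i!)² λ²ⁱ)`. -/
def f0 (l z : ℂ) : ℂ := ∑' i : ℕ, z ^ i / ((i.factorial : ℂ) ^ 2 * l ^ (2 * i))

/-- `f₁(z) = -(2/λ) ∑_{i ≥ 1} (1 + ⋯ + 1/i) zⁱ / ((i!)² λ²ⁱ)` (the term at `i = 0` vanishes). -/
def f1 (l z : ℂ) : ℂ :=
  -(2 / l) * ∑' i : ℕ, (harmonic i : ℂ) * (z ^ i / ((i.factorial : ℂ) ^ 2 * l ^ (2 * i)))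

/-- `L₀`, where `z d/dz` is written out. -/
def L0 (z l : ℂ) : Mat2 :=
  !![f0 l z, l * (z * deriv (f0 l) z);
     f1 l z, f0 l z + l * (z * deriv (f1 l) z)]

/-- The canonical complex extended frame `L = e^{tN/λ} L₀`, where `t = log z` (principal branch)
and `N = (0 0; 1 0)`, so that `e^{tN/λ} = (1 0; t/λ 1)`. It is the solution of
`L⁻¹ dL = (1/λ) (0 1; 1/z 0) dz` with `L₀(0) = I`. -/
def L (z : ℂ) (l : Circle) : Mat2 := !![1, 0; Complex.log z / l, 1] * L0 z l

/-- The loop `γ₀`. -/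
def gamma0 (a : ℝ) (l : Circle) : Mat2 :=
  !![1 / (√a : ℂ), -(l : ℂ) / (√a : ℂ); 0, (√a : ℂ)]

end

end CP1

namespace CP1

/-- A sequence in a normed space that decays like the coefficients of an entire function of
exponential type. -/
def ExpDecay {E : Type*} [NormedAddCommGroup E] (a : ℕ → E) : Prop :=
  ∃ C q : ℝ, 0 ≤ C ∧ 0 ≤ q ∧ ∀ i, ‖a i‖ ≤ C * q ^ i / i.factorial

section PowerSeries

variable {E : Type*} [NormedAddCommGroup E] [NormedSpace ℂ E]

lemma ExpDecay.exists_bound {a : ℕ → E} (ha : ExpDecay a) (r : ℝ) (hr : 0 ≤ r) :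
    ∃ u : ℕ → ℝ, Summable u ∧ ∀ i, ∀ z ∈ Metric.ball (0 : ℂ) r, ‖z ^ i • a i‖ ≤ u i := by
  obtain ⟨C, q, hC, hq, h⟩ := ha
  refine ⟨fun i => C * ((r * q) ^ i / i.factorial),
    (Real.summable_pow_div_factorial (r * q)).mul_left C, fun i z hz => ?_⟩
  have hz' : ‖z‖ ≤ r := by simpa using (Metric.mem_ball.1 hz).le
  rw [norm_smul, norm_pow]
  calc ‖z‖ ^ i * ‖a i‖ ≤ r ^ i * (C * q ^ i / i.factorial) := by
        gcongr
        exact h i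
    _ = _ := by simp only [mul_pow]; ring

variable [CompleteSpace E]

lemma ExpDecay.summable {a : ℕ → E} (ha : ExpDecay a) (z : ℂ) :
    Summable fun i => z ^ i • a i := by
  obtain ⟨u, hu, h⟩ := ha.exists_bound (‖z‖ + 1) (by positivity)
  exact hu.of_norm_bounded fun i => h i z (by simp)

lemma ExpDecay.differentiable {a : ℕ → E} (ha : ExpDecay a) :
    Differentiable ℂ fun z : ℂ => ∑' i, z ^ i • a i := by
  intro z
  obtain ⟨u, hu, h⟩ := ha.exists_bound (‖z‖ + 1) (by positivity)
  exact (Complex.differentiableOn_tsum_of_summable_norm hu (fun i => by fun_prop)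
    Metric.isOpen_ball h).differentiableAt (Metric.isOpen_ball.mem_nhds (by simp))

lemma ExpDecay.deriv_eq {a : ℕ → E} (ha : ExpDecay a) (z : ℂ) :
    HasSum (fun i : ℕ => ((i : ℂ) * z ^ (i - 1)) • a i) (deriv (fun z : ℂ => ∑' i, z ^ i • a i) z) := by
  obtain ⟨u, hu, h⟩ := ha.exists_bound (‖z‖ + 1) (by positivity)
  have := Complex.hasSum_deriv_of_summable_norm (z := z) hu (fun i => by fun_prop)
    Metric.isOpen_ball h (by simp)
  refine this.congr_fun fun i => ?_
  rw [deriv_smul_const (by fun_prop)]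
  simp

end PowerSeries

/-- Coefficients of `∑ xⁱ / (i!)²`. -/
noncomputable def c0 (i : ℕ) : ℂ := 1 / (i.factorial : ℂ) ^ 2

/-- Coefficients of `∑ (1 + ⋯ + 1/i) xⁱ / (i!)²`. -/
noncomputable def c1 (i : ℕ) : ℂ := (harmonic i : ℂ) / (i.factorial : ℂ) ^ 2

lemma harmonic_le (i : ℕ) : harmonic i ≤ i := by
  induction i with
  | zero => simp
  | succ n ih =>
    rw [harmonic_succ]
    have : ((n + 1 : ℕ) : ℚ)⁻¹ ≤ 1 := inv_le_one_of_one_le₀ (by push_cast; linarith [n.cast_nonneg (α := ℚ)])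
    push_cast at this ⊢
    linarith

lemma norm_harmonic_le (i : ℕ) : ‖(harmonic i : ℂ)‖ ≤ i := by
  have h0 : 0 ≤ harmonic i := by
    unfold harmonic; positivity
  have : (harmonic i : ℂ) = ((harmonic i : ℝ) : ℂ) := by push_cast; rfl
  rw [this, Complex.norm_real, Real.norm_of_nonneg (by exact_mod_cast h0)]
  exact_mod_cast harmonic_le i

lemma expDecay_of_le {a : ℕ → ℂ} (h : ∀ i : ℕ, ‖a i‖ ≤ (i : ℝ) ^ 2 / (i.factorial : ℝ) ^ 2 ∨
    ‖a i‖ ≤ 1 / (i.factorial : ℝ) ^ 2 ∨ ‖a i‖ ≤ i / (i.factorial : ℝ) ^ 2) : ExpDecay a := by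
  refine ⟨1, 4, by norm_num, by norm_num, fun i => ?_⟩
  have h1 : (1 : ℝ) ≤ i.factorial := by exact_mod_cast i.factorial_pos
  have h2 : (i : ℝ) ≤ 2 ^ i := by exact_mod_cast Nat.lt_two_pow_self.le
  have h3 : (4 : ℝ) ^ i = (2 ^ i) ^ 2 := by rw [← pow_mul, mul_comm, pow_mul]; norm_num
  have h4 : (1 : ℝ) ≤ 2 ^ i := one_le_pow₀ (by norm_num)
  have key : ∀ c : ℝ, c ≤ (2 ^ i) ^ 2 → c / (i.factorial : ℝ) ^ 2 ≤ 1 * 4 ^ i / i.factorial := by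
    intro c hc
    rw [h3, one_mul]
    gcongr
    nlinarith
  rcases h i with h | h | h <;> refine h.trans (key _ ?_)
  · gcongr
  · nlinarith
  · nlinarith

lemma expDecay_c0 : ExpDecay c0 := expDecay_of_le fun i => .inr <| .inl <| by simp [c0]

lemma expDecay_c1 : ExpDecay c1 := expDecay_of_le fun i => .inr <| .inr <| by
  simp only [c1, norm_div, norm_pow, Complex.norm_natCast]
  gcongr
  exact norm_harmonic_le i

lemma expDecay_mul_c0 : ExpDecay fun i => (i : ℂ) * c0 i := expDecay_of_le fun i => .inr <| .inr <| by
  simp [c0, div_eq_mul_inv]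

lemma expDecay_mul_c1 : ExpDecay fun i => (i : ℂ) * c1 i := expDecay_of_le fun i => .inl <| by
  simp only [c1, norm_div, norm_mul, norm_pow, Complex.norm_natCast]
  rw [← mul_div_assoc, sq (i : ℝ)]
  gcongr
  exact norm_harmonic_le i

/-- The power series with coefficients `a`. -/
noncomputable def pser (a : ℕ → ℂ) (x : ℂ) : ℂ := ∑' i, x ^ i • a i

lemma differentiable_pser {a : ℕ → ℂ} (ha : ExpDecay a) : Differentiable ℂ (pser a) :=
  ha.differentiable

lemma pser_zero (a : ℕ → ℂ) : pser a 0 = a 0 := by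
  unfold pser
  rw [tsum_eq_single 0]
  · simp
  · intro i hi; simp [hi]

/-- `x · d/dx` multiplies the `i`-th coefficient by `i`. -/
lemma mul_deriv_pser {a : ℕ → ℂ} (ha : ExpDecay a) (x : ℂ) :
    x * deriv (pser a) x = pser (fun i => (i : ℂ) * a i) x := by
  have h := (ha.deriv_eq x).mul_left x
  unfold pser
  rw [← h.tsum_eq]
  refine tsum_congr fun i => ?_
  rcases i with _ | i
  · simp
  · simp [pow_succ]; ring

lemma deriv_pser_of_succ {a b : ℕ → ℂ} (ha : ExpDecay a)
    (hab : ∀ i : ℕ, ((i : ℂ) + 1) * a (i + 1) = b i) (x : ℂ) : deriv (pser a) x = pser b x := by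
  have h := ha.deriv_eq x
  have h2 := (hasSum_nat_add_iff' 1).2 h
  simp only [Finset.range_one, Finset.sum_singleton, Nat.cast_zero, zero_mul, zero_smul,
    sub_zero] at h2
  change deriv (fun z : ℂ => ∑' i, z ^ i • a i) x = _
  rw [← h2.tsum_eq]
  refine tsum_congr fun i => ?_
  simp [← hab]; ring

lemma c0_succ (i : ℕ) : ((i : ℂ) + 1) * (((i : ℂ) + 1) * c0 (i + 1)) = c0 i := by
  have h1 : (i : ℂ) + 1 ≠ 0 := Nat.cast_add_one_ne_zero i
  have h2 : (i.factorial : ℂ) ≠ 0 := by exact_mod_cast i.factorial_ne_zero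
  simp only [c0, Nat.factorial_succ]
  push_cast
  field_simp

lemma c1_succ (i : ℕ) : ((i : ℂ) + 1) * (((i : ℂ) + 1) * c1 (i + 1)) =
    c1 i + ((i : ℂ) + 1) * c0 (i + 1) := by
  have h1 : (i : ℂ) + 1 ≠ 0 := Nat.cast_add_one_ne_zero i
  have h2 : (i.factorial : ℂ) ≠ 0 := by exact_mod_cast i.factorial_ne_zero
  simp only [c0, c1, Nat.factorial_succ, harmonic_succ]
  push_cast
  field_simp

lemma pser_add {a b : ℕ → ℂ} (ha : ExpDecay a) (hb : ExpDecay b) (x : ℂ) :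
    pser (fun i => a i + b i) x = pser a x + pser b x := by
  unfold pser
  rw [← (ha.summable x).tsum_add (hb.summable x)]
  simp [mul_add]

/-- The functions `∑ xⁱ/(i!)²`, its image under `x d/dx`, and the same for `∑ hᵢ xⁱ/(i!)²`. -/
noncomputable def g0 : ℂ → ℂ := pser c0
noncomputable def u0 : ℂ → ℂ := pser fun i => (i : ℂ) * c0 i
noncomputable def g1 : ℂ → ℂ := pser c1
noncomputable def u1 : ℂ → ℂ := pser fun i => (i : ℂ) * c1 i

lemma differentiable_g0 : Differentiable ℂ g0 := differentiable_pser expDecay_c0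
lemma differentiable_u0 : Differentiable ℂ u0 := differentiable_pser expDecay_mul_c0
lemma differentiable_g1 : Differentiable ℂ g1 := differentiable_pser expDecay_c1
lemma differentiable_u1 : Differentiable ℂ u1 := differentiable_pser expDecay_mul_c1

lemma mul_deriv_g0 (x : ℂ) : x * deriv g0 x = u0 x := mul_deriv_pser expDecay_c0 x
lemma mul_deriv_g1 (x : ℂ) : x * deriv g1 x = u1 x := mul_deriv_pser expDecay_c1 x

lemma deriv_u0 (x : ℂ) : deriv u0 x = g0 x := by
  refine deriv_pser_of_succ expDecay_mul_c0 (fun i => ?_) x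
  push_cast
  exact c0_succ i

lemma deriv_u1 (x : ℂ) : deriv u1 x = g1 x + deriv g0 x := by
  have hdec : ExpDecay fun i : ℕ => ((i : ℂ) + 1) * c0 (i + 1) := by
    refine expDecay_of_le fun i => .inr <| .inl ?_
    have h1 : (i : ℂ) + 1 ≠ 0 := Nat.cast_add_one_ne_zero i
    have : ((i : ℂ) + 1) * c0 (i + 1) = c0 i / ((i : ℂ) + 1) := by
      rw [eq_div_iff h1, ← c0_succ i]; ring
    rw [this]
    have h2 : (1 : ℝ) ≤ ‖(i : ℂ) + 1‖ := by
      rw [← Nat.cast_add_one, Complex.norm_natCast]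
      simp
    simp only [c0, norm_div, norm_pow, Complex.norm_natCast, norm_one]
    exact div_le_self (by positivity) h2
  have h0 : deriv g0 x = pser (fun i : ℕ => ((i : ℂ) + 1) * c0 (i + 1)) x :=
    deriv_pser_of_succ expDecay_c0 (fun i => rfl) x
  rw [h0]
  change _ = pser c1 x + _
  rw [← pser_add expDecay_c1 hdec]
  refine deriv_pser_of_succ expDecay_mul_c1 (fun i => ?_) x
  push_cast
  exact c1_succ i

lemma wronskian (x : ℂ) : g0 x * (g0 x - 2 * u1 x) + 2 * (g1 x * u0 x) = 1 := by
  set W : ℂ → ℂ := fun x => g0 x * (g0 x - 2 * u1 x) + 2 * (g1 x * u0 x) with hW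
  have d0 := fun x => (differentiable_g0 x).hasDerivAt
  have d1 := fun x => (differentiable_g1 x).hasDerivAt
  have e0 := fun x => (differentiable_u0 x).hasDerivAt
  have e1 := fun x => (differentiable_u1 x).hasDerivAt
  have hd : ∀ x, HasDerivAt W 0 x := by
    intro x
    have := ((d0 x).mul ((d0 x).sub ((e1 x).const_mul 2))).add (((d1 x).mul (e0 x)).const_mul 2)
    refine (this.congr_deriv ?_)
    simp only [Pi.sub_apply]
    rw [deriv_u0, deriv_u1, ← mul_deriv_g0, ← mul_deriv_g1]
    ring
  have h := is_const_of_deriv_eq_zero (fun x => (hd x).differentiableAt) (fun x => (hd x).deriv) x 0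
  change W x = 1
  rw [h]
  simp [hW, g0, g1, u0, u1, pser_zero, c0, c1]

lemma f0_eq (l : ℂ) : f0 l = fun z => g0 (z / l ^ 2) := by
  funext z
  unfold f0 g0 pser
  refine tsum_congr fun i => ?_
  simp only [c0, smul_eq_mul, div_pow, ← pow_mul]
  ring

lemma f1_eq (l : ℂ) : f1 l = fun z => -(2 / l) * g1 (z / l ^ 2) := by
  funext z
  unfold f1 g1 pser
  congr 1
  refine tsum_congr fun i => ?_
  simp only [c1, smul_eq_mul, div_pow, ← pow_mul]
  ring

lemma L0_eq (z l : ℂ) (hl : l ≠ 0) : L0 z l =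
    !![g0 (z / l ^ 2), l * u0 (z / l ^ 2);
       -(2 / l) * g1 (z / l ^ 2), g0 (z / l ^ 2) - 2 * u1 (z / l ^ 2)] := by
  have hd : ∀ g : ℂ → ℂ, Differentiable ℂ g →
      deriv (fun z => g (z / l ^ 2)) z = deriv g (z / l ^ 2) / l ^ 2 := by
    intro g hg
    have := (hg (z / l ^ 2)).hasDerivAt.comp z ((hasDerivAt_id z).div_const (l ^ 2))
    simpa [Function.comp_def, div_eq_mul_inv] using this.deriv
  have h0 : deriv (f0 l) z = deriv g0 (z / l ^ 2) / l ^ 2 := by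
    rw [f0_eq, hd _ differentiable_g0]
  have h1 : deriv (f1 l) z = -(2 / l) * (deriv g1 (z / l ^ 2) / l ^ 2) := by
    rw [f1_eq, deriv_const_mul_field, hd _ differentiable_g1]
  have e0 : l * (z * (deriv g0 (z / l ^ 2) / l ^ 2)) = l * (z / l ^ 2 * deriv g0 (z / l ^ 2)) := by
    ring
  have e1 : g0 (z / l ^ 2) + l * (z * (-(2 / l) * (deriv g1 (z / l ^ 2) / l ^ 2))) =
      g0 (z / l ^ 2) - 2 * (z / l ^ 2 * deriv g1 (z / l ^ 2)) := by
    field_simp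
    ring
  rw [L0, h0, h1, f0_eq, f1_eq, ← mul_deriv_g0, ← mul_deriv_g1, ← e0, ← e1]

lemma det_L0 (z l : ℂ) (hl : l ≠ 0) : (L0 z l).det = 1 := by
  rw [L0_eq z l hl, Matrix.det_fin_two_of, ← wronskian (z / l ^ 2)]
  field_simp
  ring

section Disk

open Metric Matrix

/-- A function on the closed unit disk, holomorphic in the interior and real on the circle,
vanishes if it vanishes at the centre. -/
lemma eq_zero_of_im_eq_zero_on_sphere {h : ℂ → ℂ} (hd : DiffContOnCl ℂ h (ball 0 1)) (h0 : h 0 = 0)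
    (hr : ∀ l ∈ sphere (0 : ℂ) 1, (h l).im = 0) : ∀ m ∈ closedBall (0 : ℂ) 1, h m = 0 := by
  have hfr : frontier (ball (0 : ℂ) 1) = sphere 0 1 := frontier_ball _ one_ne_zero
  have hcl : closure (ball (0 : ℂ) 1) = closedBall 0 1 := closure_ball _ one_ne_zero
  have hre : ∀ l ∈ sphere (0 : ℂ) 1, h l = ((h l).re : ℂ) := fun l hl =>
    Complex.ext (by simp) (by simpa using hr l hl)
  set E : ℂ → ℂ := fun m => Complex.exp (-(h m) ^ 2) with hE
  have hEd : DiffContOnCl ℂ E (ball 0 1) := by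
    refine ⟨?_, ?_⟩
    · have := hd.differentiableOn
      fun_prop
    · have := hd.continuousOn
      fun_prop
  have hEl : ∀ l ∈ sphere (0 : ℂ) 1, E l = (Real.exp (-(h l).re ^ 2) : ℂ) := by
    intro l hl
    simp only [hE]
    rw [hre l hl]
    push_cast
    simp
  have hbd : ∀ m ∈ closedBall (0 : ℂ) 1, ‖E m‖ ≤ 1 := by
    intro m hm
    refine Complex.norm_le_of_forall_mem_frontier_norm_le isBounded_ball hEd ?_ (hcl ▸ hm)
    intro l hl
    rw [hEl l (hfr ▸ hl), Complex.norm_real, Real.norm_of_nonneg (Real.exp_pos _).le]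
    exact Real.exp_le_one_iff.2 (by nlinarith [sq_nonneg (h l).re])
  have hE0 : E 0 = 1 := by simp [hE, h0]
  have hconst := Complex.eqOn_closedBall_of_isMaxOn_norm hEd (fun m hm => by
    simpa [hE0] using hbd m (ball_subset_closedBall hm))
  have hs : ∀ l ∈ sphere (0 : ℂ) 1, h l = 0 := by
    intro l hl
    have h1 := hconst (sphere_subset_closedBall hl)
    rw [Function.const_apply, hE0, hEl l hl] at h1
    have h2 : Real.exp (-(h l).re ^ 2) = 1 := by exact_mod_cast h1
    rw [Real.exp_eq_one_iff] at h2
    rw [hre l hl, pow_eq_zero_iff two_ne_zero |>.1 (neg_eq_zero.1 h2)]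
    simp
  intro m hm
  have := Complex.norm_le_of_forall_mem_frontier_norm_le isBounded_ball hd (C := 0)
    (fun l hl => by rw [hs l (hfr ▸ hl)]; simp) (hcl ▸ hm)
  simpa using this

/-- If `f` and `g` are holomorphic in the disk and `f = conj g` on the circle, then `f` and `g` are
constant. -/
lemma eq_const_of_eq_conj_on_circle {f g : ℂ → ℂ} (hf : DifferentiableOn ℂ f (ball 0 2))
    (hg : DifferentiableOn ℂ g (ball 0 2)) (h : ∀ l : Circle, f l = conj (g l)) :
    (∀ m ∈ closedBall (0 : ℂ) 1, f m = f 0) ∧ f 0 = conj (g 0) := by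
  have hsub : closure (ball (0 : ℂ) 1) ⊆ ball 0 2 := by
    rw [closure_ball _ one_ne_zero]
    exact closedBall_subset_ball (by norm_num)
  have hc : ∀ {h : ℂ → ℂ}, DifferentiableOn ℂ h (ball 0 2) → DiffContOnCl ℂ h (ball 0 1) :=
    fun h => (h.mono hsub).diffContOnCl
  have hl : ∀ l ∈ sphere (0 : ℂ) 1, f l = conj (g l) := fun l hl =>
    h ⟨l, by simpa [Submonoid.unitSphere] using hl⟩
  have real_at_zero : ∀ {k : ℂ → ℂ}, DifferentiableOn ℂ k (ball 0 2) →
      (∀ l ∈ sphere (0 : ℂ) 1, (k l).im = 0) →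
      (k 0).im = 0 ∧ ∀ m ∈ closedBall (0 : ℂ) 1, k m = k 0 := by
    intro k hk hkr
    have e0 : ∀ m ∈ closedBall (0 : ℂ) 1, (k m - k 0) * (k m - conj (k 0)) -
        (k 0 - k 0) * (k 0 - conj (k 0)) = 0 := by
      refine eq_zero_of_im_eq_zero_on_sphere (hc (by fun_prop)) (by simp) fun l hl => ?_
      have := hkr l hl
      simp [this]
      ring
    have e1 : ∀ l ∈ sphere (0 : ℂ) 1, k l = k 0 := by
      intro l hl
      have := e0 l (sphere_subset_closedBall hl)
      simp only [sub_self, zero_mul, sub_zero] at this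
      rcases mul_eq_zero.1 this with h1 | h1
      · linear_combination h1
      · have h2 : k l = conj (k 0) := by linear_combination h1
        have h3 : (k 0).im = 0 := by
          have := hkr l hl
          rw [h2] at this
          simpa using this
        rw [h2]
        exact Complex.ext (by simp) (by simp [h3])
    have e2 : ∀ m ∈ closedBall (0 : ℂ) 1, k m = k 0 := by
      intro m hm
      have hk' : DiffContOnCl ℂ (fun m => k m - k 0) (ball 0 1) := hc (by fun_prop)
      have := Complex.norm_le_of_forall_mem_frontier_norm_le isBounded_ball hk' (C := 0)
        (fun l hl => by
          rw [e1 l (by rwa [frontier_ball _ one_ne_zero] at hl)]; simp)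
        (by rwa [closure_ball _ one_ne_zero])
      exact sub_eq_zero.1 (by simpa using this)
    have h1 : (1 : ℂ) ∈ sphere (0 : ℂ) 1 := by simp
    exact ⟨by rw [← e1 1 h1]; exact hkr 1 h1, e2⟩
  obtain ⟨a0, a⟩ := real_at_zero (k := fun m => f m + g m) (by fun_prop) fun l h => by
    simp [hl l h]
  obtain ⟨b0, b⟩ := real_at_zero (k := fun m => Complex.I * (f m - g m)) (by fun_prop) fun l h => by
    simp [hl l h]
  refine ⟨fun m hm => ?_, ?_⟩
  · have h1 := a m hm
    have h2 := b m hm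
    have h3 := mul_left_cancel₀ Complex.I_ne_zero h2
    linear_combination h1 / 2 + h3 / 2
  · simp at a0 b0
    exact Complex.ext (by simp; linarith) (by simp; linarith)

/-- Matrix valued functions, holomorphic on the disk of radius `2`. -/
def Hol (G : ℂ → Mat2) : Prop :=
  ∀ i j, DifferentiableOn ℂ (fun m => G m i j) (ball 0 2)

lemma Hol.mul {G K : ℂ → Mat2} (hG : Hol G) (hK : Hol K) : Hol fun m => G m * K m := by
  intro i j
  simp only [Matrix.mul_apply, Fin.sum_univ_two]
  exact ((hG _ _).mul (hK _ _)).add ((hG _ _).mul (hK _ _))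

lemma hol_const (A : Mat2) : Hol fun _ => A := fun i j => by fun_prop

lemma Hol.det {G : ℂ → Mat2} (hG : Hol G) : DifferentiableOn ℂ (fun m => (G m).det) (ball 0 2) := by
  simp only [Matrix.det_fin_two]
  exact ((hG _ _).mul (hG _ _)).sub ((hG _ _).mul (hG _ _))

lemma Hol.adjugate {G : ℂ → Mat2} (hG : Hol G) : Hol fun m => (G m).adjugate := by
  intro i j
  simp only [Matrix.adjugate_fin_two]
  fin_cases i <;> fin_cases j
  · exact hG 1 1
  · exact (hG 0 1).neg
  · exact (hG 1 0).neg
  · exact hG 0 0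

lemma Hol.comp_mul {G : ℂ → Mat2} (hG : Hol G) (e : Circle) : Hol fun m => G (e * m) := fun i j =>
  (hG i j).comp (by fun_prop) fun m hm => by
    have : ‖(e : ℂ)‖ = 1 := e.norm_coe
    simpa [this] using hm

lemma Hol.eq_const {G K : ℂ → Mat2} (hG : Hol G) (hK : Hol K) (h : ∀ l : Circle, G l = (K l)ᴴ) :
    (∀ m ∈ closedBall (0 : ℂ) 1, G m = G 0) ∧ G 0 = (K 0)ᴴ := by
  have := fun i j => eq_const_of_eq_conj_on_circle (hG i j) (hK j i) fun l => by
    rw [h l]; simp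
  exact ⟨fun m hm => by ext i j; exact (this i j).1 m hm, by ext i j; simpa using (this i j).2⟩

lemma D_mul_D : D * D = 1 := by
  simp [D, Matrix.one_fin_two]

lemma D_conjTranspose : Dᴴ = D := by
  ext i j
  fin_cases i <;> fin_cases j <;> simp [D]

lemma D_mul (A : Mat2) : D * A = !![A 0 0, A 0 1; -A 1 0, -A 1 1] := by
  ext i j
  fin_cases i <;> fin_cases j <;> simp [D, Matrix.mul_apply]

lemma mul_D (A : Mat2) : A * D = !![A 0 0, -A 0 1; A 1 0, -A 1 1] := by
  ext i j
  fin_cases i <;> fin_cases j <;> simp [D, Matrix.mul_apply]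

lemma det_D : D.det = -1 := by simp [D]

/-- A Birkhoff factorization `D H P = Qᴴ` of the loop `D H`, with `P`, `Q` holomorphic. -/
structure IsBirkhoff (H : Circle → Mat2) (P Q : ℂ → Mat2) : Prop where
  hol_left : Hol P
  hol_right : Hol Q
  right_zero : Q 0 = 1
  eq : ∀ l : Circle, D * H l * P l = (Q l)ᴴ

variable {H : Circle → Mat2} {P Q P' Q' : ℂ → Mat2}

lemma IsBirkhoff.mul_eq (h : IsBirkhoff H P Q) (l : Circle) : H l * P l = D * (Q l)ᴴ := by
  rw [← h.eq, ← Matrix.mul_assoc, ← Matrix.mul_assoc, D_mul_D, Matrix.one_mul]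

lemma IsBirkhoff.conjTranspose_mul_eq (h : IsBirkhoff H P Q) (hH : ∀ l, (H l)ᴴ = H l) (l : Circle) :
    (P l)ᴴ * H l = Q l * D := by
  have := congrArg conjTranspose (h.mul_eq l)
  rwa [conjTranspose_mul, conjTranspose_mul, hH, conjTranspose_conjTranspose, D_conjTranspose] at this

lemma IsBirkhoff.pairing (h : IsBirkhoff H P Q) (h' : IsBirkhoff H P' Q') (hH : ∀ l, (H l)ᴴ = H l) :
    (∀ m ∈ closedBall (0 : ℂ) 1, Q m * D * P' m = D * P' 0) ∧ D * P' 0 = (D * P 0)ᴴ := by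
  have := Hol.eq_const ((h.hol_right.mul (hol_const D)).mul h'.hol_left)
    ((h'.hol_right.mul (hol_const D)).mul h.hol_left) fun l => by
      rw [← h.conjTranspose_mul_eq hH, Matrix.mul_assoc, h'.mul_eq, Matrix.mul_assoc,
        conjTranspose_mul (Q' l), conjTranspose_mul, D_conjTranspose, Matrix.mul_assoc]
  simpa [h.right_zero, h'.right_zero] using this

lemma IsBirkhoff.det_eq_one (h : IsBirkhoff H P Q) (hdet : ∀ l, (H l).det = -1) :
    ∀ m ∈ closedBall (0 : ℂ) 1, (P m).det = 1 := by
  have := eq_const_of_eq_conj_on_circle h.hol_left.det h.hol_right.det fun l => by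
    have := congrArg Matrix.det (h.eq l)
    rw [det_mul, det_mul, det_D, hdet, det_conjTranspose] at this
    simpa using this
  intro m hm
  rw [this.1 m hm, this.2, h.right_zero]
  simp

lemma IsBirkhoff.unique (h : IsBirkhoff H P Q) (h' : IsBirkhoff H P' Q')
    (hH : ∀ l, (H l)ᴴ = H l) (hdet : ∀ l, (H l).det = -1) :
    ∀ m ∈ closedBall (0 : ℂ) 1, P m = P' m := by
  intro m hm
  have e1 := (h.pairing h hH).1 m hm
  have e2 := (h.pairing h' hH).1 m hm
  rw [(h.pairing h' hH).2, ← (h.pairing h hH).2, ← e1] at e2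
  have hu : IsUnit (Q m * D) := by
    rw [Matrix.isUnit_iff_isUnit_det]
    have := congrArg Matrix.det e1
    rw [det_mul, h.det_eq_one hdet m hm, det_mul D, det_D, h.det_eq_one hdet 0 (by simp)] at this
    refine isUnit_iff_ne_zero.2 fun h0 => ?_
    rw [h0] at this
    norm_num at this
  exact (hu.mul_left_cancel e2).symm

lemma IsBirkhoff.rotate (h : IsBirkhoff H P Q) (e : Circle) {u : Mat2} (hu : uᴴ * u = 1)
    (huD : u * D = D * u) :
    IsBirkhoff (fun l => u * H (e * l) * uᴴ) (fun m => u * P (e * m) * uᴴ)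
      (fun m => u * Q (e * m) * uᴴ) where
  hol_left := ((hol_const _).mul (h.hol_left.comp_mul e)).mul (hol_const _)
  hol_right := ((hol_const _).mul (h.hol_right.comp_mul e)).mul (hol_const _)
  right_zero := by
    simp [h.right_zero, mul_eq_one_comm.1 hu]
  eq l := by
    rw [conjTranspose_mul, conjTranspose_mul, conjTranspose_conjTranspose]
    have := h.eq (e * l)
    rw [Circle.coe_mul] at this
    rw [← this]
    calc D * (u * H (e * l) * uᴴ) * (u * P (e * l) * uᴴ)
        = (D * u) * H (e * l) * (uᴴ * u) * P (e * l) * uᴴ := by simp only [Matrix.mul_assoc]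
      _ = _ := by rw [hu, ← huD]; simp only [Matrix.mul_assoc, Matrix.one_mul]

/-- The solution of the Birkhoff problem at the centre of the disk, for a twisted loop. -/
lemma IsBirkhoff.left_zero (h : IsBirkhoff H P Q) (hH : ∀ l, (H l)ᴴ = H l)
    (hdet : ∀ l, (H l).det = -1) (htw : ∀ l m : Circle, (m : ℂ) = -l → D * H m * D = H l) :
    P 0 = !![((P 0 0 0).re : ℂ), 0; 0, ((P 0 0 0).re : ℂ)⁻¹] := by
  have hrot := h.rotate (-1) (u := D) (by rw [D_conjTranspose, D_mul_D]) rfl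
  rw [D_conjTranspose] at hrot
  have hHeq : (fun l => D * H (-1 * l) * D) = H := by
    funext l
    exact htw l _ (by simp)
  rw [hHeq] at hrot
  have h1 := hrot.unique h hH hdet 0 (by simp)
  simp only [mul_zero] at h1
  have h2 := (h.pairing h hH).2
  have h3 := h.det_eq_one hdet 0 (by simp)
  rw [mul_D, D_mul] at h1
  rw [D_mul] at h2
  have a01 := congrFun₂ h1 0 1
  have a10 := congrFun₂ h1 1 0
  have b00 := congrFun₂ h2 0 0
  rw [det_fin_two] at h3
  simp at a01 a10 b00
  have z01 : P 0 0 1 = 0 := by linear_combination (-1 / 2 : ℂ) * a01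
  have z10 : P 0 1 0 = 0 := by linear_combination (-1 / 2 : ℂ) * a10
  have hre : ((P 0 0 0).re : ℂ) = P 0 0 0 := Complex.conj_eq_iff_re.1 b00.symm
  rw [z01, zero_mul, sub_zero] at h3
  rw [hre]
  ext i j
  fin_cases i <;> fin_cases j <;> simp [z01, z10]
  exact eq_inv_of_mul_eq_one_right h3

end Disk

section Sequences

set_option maxSynthPendingDepth 3

open Metric BoundedContinuousFunction

/-- Bounded sequences `b`, which stand for the Laurent series `∑ 2^{-|n|} bₙ λⁿ`. -/
abbrev LaurentSpace : Type := BoundedContinuousFunction ℤ (Fin 2 → ℂ)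

/-- Operators on the space of Laurent series. -/
abbrev LaurentOp : Type := LaurentSpace →L[ℂ] LaurentSpace

lemma norm_evalCLM_le (n : ℤ) : ‖(evalCLM ℂ n : LaurentSpace →L[ℂ] (Fin 2 → ℂ))‖ ≤ 1 :=
  ContinuousLinearMap.opNorm_le_bound _ zero_le_one fun b => by
    simpa using b.norm_coe_le_norm n

lemma summable_weight : Summable fun n : ℤ => (2 : ℝ) ^ (-|n|) := by
  have h : Summable fun n : ℕ => (2 : ℝ)⁻¹ ^ n :=
    summable_geometric_of_lt_one (by norm_num) (by norm_num)
  refine Summable.of_nat_of_neg ?_ ?_ <;> simpa using h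

lemma summable_ev (l : Circle) : Summable fun n : ℤ =>
    ((2 : ℂ) ^ (-|n|) * (l : ℂ) ^ n) • (evalCLM ℂ n : LaurentSpace →L[ℂ] (Fin 2 → ℂ)) := by
  refine summable_weight.of_norm_bounded fun n => ?_
  rw [norm_smul, norm_mul, norm_zpow, norm_zpow, Circle.norm_coe]
  simpa using mul_le_mul_of_nonneg_left (norm_evalCLM_le n)
    (by positivity : (0 : ℝ) ≤ 2 ^ (-|n|))

/-- Evaluation of a Laurent series on the unit circle. -/
noncomputable def ev (l : Circle) : LaurentSpace →L[ℂ] (Fin 2 → ℂ) :=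
  ∑' n : ℤ, ((2 : ℂ) ^ (-|n|) * (l : ℂ) ^ n) • evalCLM ℂ n

lemma hasSum_ev (l : Circle) (b : LaurentSpace) :
    HasSum (fun n : ℤ => ((2 : ℂ) ^ (-|n|) * (l : ℂ) ^ n) • b n) (ev l b) := by
  exact (summable_ev l).hasSum.mapL (ContinuousLinearMap.apply ℂ (Fin 2 → ℂ) b)

/-- Evaluation of the holomorphic part of a Laurent series. -/
noncomputable def evp (m : ℂ) : LaurentSpace →L[ℂ] (Fin 2 → ℂ) :=
  ∑' n : ℕ, m ^ n • ((2 : ℂ)⁻¹ ^ n • evalCLM ℂ (n : ℤ))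

lemma evp_bound {r : ℝ} (n : ℕ) {m : ℂ} (hm : m ∈ ball (0 : ℂ) r) :
    ‖m ^ n • ((2 : ℂ)⁻¹ ^ n • (evalCLM ℂ (n : ℤ) : LaurentSpace →L[ℂ] (Fin 2 → ℂ)))‖ ≤
      (r / 2) ^ n := by
  have hm' : ‖m‖ ≤ r := by simpa using (mem_ball.1 hm).le
  rw [norm_smul, norm_smul, norm_pow, norm_pow, norm_inv, div_pow, div_eq_mul_inv, ← inv_pow]
  have : ‖(2 : ℂ)‖ = 2 := by simp
  rw [this]
  have hr : 0 ≤ r := (norm_nonneg m).trans hm'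
  have h1 : ((2 : ℝ)⁻¹) ^ n * ‖(evalCLM ℂ (n : ℤ) : LaurentSpace →L[ℂ] (Fin 2 → ℂ))‖ ≤
      2⁻¹ ^ n := mul_le_of_le_one_right (by positivity) (norm_evalCLM_le n)
  gcongr

lemma exists_radius {m : ℂ} (hm : m ∈ ball (0 : ℂ) 2) :
    ∃ r, m ∈ ball (0 : ℂ) r ∧ Summable fun n : ℕ => (r / 2) ^ n := by
  have hm' : ‖m‖ < 2 := by simpa using hm
  have h0 := norm_nonneg m
  refine ⟨(‖m‖ + 2) / 2, by simp; linarith, summable_geometric_of_lt_one (by positivity) (by linarith)⟩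

lemma differentiableOn_evp : DifferentiableOn ℂ evp (ball 0 2) := by
  intro m hm
  obtain ⟨r, hr, hu⟩ := exists_radius hm
  exact ((Complex.differentiableOn_tsum_of_summable_norm hu (fun n => by fun_prop)
    isOpen_ball fun n m hm => evp_bound n hm).differentiableAt
      (isOpen_ball.mem_nhds hr)).differentiableWithinAt

lemma hasSum_evp {m : ℂ} (hm : m ∈ ball (0 : ℂ) 2) (b : LaurentSpace) :
    HasSum (fun n : ℕ => (m ^ n * (2 : ℂ)⁻¹ ^ n) • b n) (evp m b) := by
  obtain ⟨r, hr, hu⟩ := exists_radius hm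
  have := (hu.of_norm_bounded fun n => evp_bound n hr).hasSum.mapL
    (ContinuousLinearMap.apply ℂ (Fin 2 → ℂ) b)
  refine this.congr_fun fun n => ?_
  rw [mul_smul]
  rfl

lemma evp_zero (b : LaurentSpace) : evp 0 b = b 0 := by
  have := hasSum_evp (m := 0) (by simp) b
  refine this.unique ?_
  convert hasSum_single (f := fun n : ℕ => ((0 : ℂ) ^ n * (2 : ℂ)⁻¹ ^ n) • b n) 0 ?_ using 1
  · simp
  · intro n hn; simp [hn]

lemma circle_mem_ball (l : Circle) : (l : ℂ) ∈ ball (0 : ℂ) 2 := by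
  simp [Circle.norm_coe]

lemma ev_eq_evp (l : Circle) {b : LaurentSpace} (hb : ∀ n < 0, b n = 0) : ev l b = evp l b := by
  have h := hasSum_evp (circle_mem_ball l) b
  have h2 : HasSum (fun n : ℕ => ((2 : ℂ) ^ (-|(n : ℤ)|) * (l : ℂ) ^ (n : ℤ)) • b n) (evp l b) := by
    refine h.congr_fun fun n => ?_
    simp [mul_comm]
  refine (hasSum_ev l b).unique
    (((Nat.cast_injective (R := ℤ)).hasSum_iff ?_).1 h2)
  intro n hn
  rw [hb n, smul_zero]
  by_contra! h0
  exact hn ⟨n.toNat, by simpa using h0⟩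

/-- The reflection of a Laurent series in the unit circle. -/
noncomputable def reflect (b : LaurentSpace) : LaurentSpace :=
  ofNormedAddCommGroupDiscrete (fun n => star (b (-n))) ‖b‖ fun n => by
    rw [norm_star]; exact b.norm_coe_le_norm _

lemma reflect_apply (b : LaurentSpace) (n : ℤ) : reflect b n = star (b (-n)) := rfl

lemma star_ev (l : Circle) (b : LaurentSpace) : star (ev l b) = ev l (reflect b) := by
  have h := (hasSum_ev l b).star
  rw [← (Equiv.neg ℤ).hasSum_iff] at h
  refine (h.congr_fun fun n => ?_).unique (hasSum_ev l _)
  simp only [Function.comp_apply, Equiv.neg_apply, reflect_apply, abs_neg]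
  rw [star_smul, star_mul']
  congr 2
  · simp
  · simp [← Circle.coe_inv_eq_conj]

/-- Multiplication by `λᵏ`. -/
noncomputable def shift (k : ℤ) : LaurentOp :=
  LinearMap.mkContinuous
    { toFun := fun b => ofNormedAddCommGroupDiscrete
        (fun n => (2 : ℂ) ^ (|n| - |n - k|) • b (n - k)) (2 ^ |k| * ‖b‖) fun n => by
          rw [norm_smul, norm_zpow, Complex.norm_ofNat]
          have : |n| - |n - k| ≤ |k| := by
            have := abs_sub_abs_le_abs_sub n (n - k)
            simpa using this
          gcongr
          · norm_num
          · exact b.norm_coe_le_norm _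
      map_add' := fun b c => by ext n : 1; simp
      map_smul' := fun r b => by ext n : 1; simp [smul_comm r] }
    (2 ^ |k|) fun b => by
      refine (BoundedContinuousFunction.norm_le (by positivity)).2 fun n => ?_
      simp only [LinearMap.coe_mk, AddHom.coe_mk, coe_ofNormedAddCommGroupDiscrete]
      rw [norm_smul, norm_zpow, Complex.norm_ofNat]
      have : |n| - |n - k| ≤ |k| := by
        have := abs_sub_abs_le_abs_sub n (n - k)
        simpa using this
      gcongr
      · norm_num
      · exact b.norm_coe_le_norm _

lemma shift_apply (k : ℤ) (b : LaurentSpace) (n : ℤ) :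
    shift k b n = (2 : ℂ) ^ (|n| - |n - k|) • b (n - k) := rfl

lemma ev_shift (l : Circle) (k : ℤ) (b : LaurentSpace) : ev l (shift k b) = (l : ℂ) ^ k • ev l b := by
  have h := (hasSum_ev l b).const_smul ((l : ℂ) ^ k)
  rw [← (Equiv.subRight k).hasSum_iff] at h
  refine (hasSum_ev l _).unique (h.congr_fun fun n => ?_)
  simp only [Function.comp_apply, Equiv.subRight_apply, shift_apply, smul_smul]
  congr 1
  have h2 : (2 : ℂ) ≠ 0 := two_ne_zero
  have hl : (l : ℂ) ≠ 0 := l.coe_ne_zero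
  rw [mul_right_comm, ← zpow_add₀ h2, mul_left_comm, ← zpow_add₀ hl]
  congr 2 <;> ring

/-- Multiplication by a constant matrix. -/
noncomputable def constOp (A : Mat2) : LaurentOp :=
  (LinearMap.toContinuousLinearMap A.mulVecLin).compLeftContinuousBounded ℤ

lemma constOp_apply (A : Mat2) (b : LaurentSpace) (n : ℤ) : constOp A b n = A.mulVec (b n) := rfl

lemma ev_constOp (l : Circle) (A : Mat2) (b : LaurentSpace) :
    ev l (constOp A b) = A.mulVec (ev l b) := by
  have h := (hasSum_ev l b).mapL (LinearMap.toContinuousLinearMap A.mulVecLin)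
  refine (hasSum_ev l _).unique (h.congr_fun fun n => ?_)
  rw [map_smul]
  rfl

/-- The projection to the holomorphic part. -/
noncomputable def holPart : LaurentOp :=
  LinearMap.mkContinuous
    { toFun := fun b => ofNormedAddCommGroupDiscrete (fun n => if 0 ≤ n then b n else 0) ‖b‖
        fun n => by
          split_ifs
          · exact b.norm_coe_le_norm _
          · simp
      map_add' := fun b c => by ext n : 1; by_cases h : 0 ≤ n <;> simp [h]
      map_smul' := fun r b => by ext n : 1; by_cases h : 0 ≤ n <;> simp [h] }
    1 fun b => by
      rw [one_mul]
      refine (BoundedContinuousFunction.norm_le (by positivity)).2 fun n => ?_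
      simp only [LinearMap.coe_mk, AddHom.coe_mk, coe_ofNormedAddCommGroupDiscrete]
      split_ifs
      · exact b.norm_coe_le_norm _
      · simp

/-- A constant vector, as a Laurent series. -/
noncomputable def constVec (v : Fin 2 → ℂ) : LaurentSpace :=
  ofNormedAddCommGroupDiscrete (fun n => if n = 0 then v else 0) ‖v‖ fun n => by
    split_ifs <;> simp

lemma constVec_apply (v : Fin 2 → ℂ) (n : ℤ) : constVec v n = if n = 0 then v else 0 := rfl

/-- The projected equation `Π M p = v` for a constant vector `v`, where `p` has no principal part:
the product `M p` then reflects to a power series with constant term `v̄`. -/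
lemma projected_equation {M : LaurentOp} {p : LaurentSpace} {v : Fin 2 → ℂ}
    (h : (1 + holPart * (M - 1)) p = constVec v) :
    (∀ n < 0, p n = 0) ∧ (∀ n > 0, M p n = 0) ∧ M p 0 = v := by
  have h' : ∀ n, p n + (if 0 ≤ n then M p n - p n else 0) = if n = 0 then v else 0 := fun n =>
    DFunLike.congr_fun h n
  refine ⟨fun n hn => ?_, fun n hn => ?_, ?_⟩
  · simpa [hn.not_ge, hn.ne] using h' n
  · simpa [hn.le, hn.ne'] using h' n
  · simpa using h' 0

lemma norm_op_pow_le (T : LaurentOp) (i : ℕ) : ‖T ^ i‖ ≤ ‖T‖ ^ i := by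
  induction i with
  | zero => rw [pow_zero, pow_zero]; exact ContinuousLinearMap.norm_id_le
  | succ n ih =>
    rw [pow_succ, pow_succ]
    exact (norm_mul_le _ _).trans (by gcongr)

lemma ExpDecay.smul_pow {a : ℕ → ℂ} (ha : ExpDecay a) (T : LaurentOp) :
    ExpDecay fun i => a i • T ^ i := by
  obtain ⟨C, q, hC, hq, h⟩ := ha
  refine ⟨C, q * ‖T‖, hC, by positivity, fun i => ?_⟩
  rw [norm_smul]
  calc ‖a i‖ * ‖T ^ i‖ ≤ (C * q ^ i / i.factorial) * ‖T‖ ^ i := by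
        gcongr
        · exact h i
        · exact norm_op_pow_le T i
    _ = _ := by rw [mul_pow]; ring

/-- The power series with coefficients `a`, evaluated at `z T`. -/
noncomputable def opSer (a : ℕ → ℂ) (T : LaurentOp) (z : ℂ) : LaurentOp :=
  ∑' i, z ^ i • (a i • T ^ i)

lemma differentiable_opSer {a : ℕ → ℂ} (ha : ExpDecay a) (T : LaurentOp) :
    Differentiable ℂ (opSer a T) := (ha.smul_pow T).differentiable

lemma opSer_zero (a : ℕ → ℂ) (T : LaurentOp) : opSer a T 0 = a 0 • 1 := by
  unfold opSer
  rw [tsum_eq_single 0]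
  · simp
  · intro i hi; simp [hi]

lemma ev_opSer {a : ℕ → ℂ} (ha : ExpDecay a) {T : LaurentOp} {l : Circle} {c : ℂ}
    (hT : ∀ b, ev l (T b) = c • ev l b) (z : ℂ) (b : LaurentSpace) :
    ev l (opSer a T z b) = pser a (z * c) • ev l b := by
  have hTi : ∀ i, ev l ((T ^ i) b) = c ^ i • ev l b := by
    intro i
    induction i with
    | zero => simp
    | succ n ih =>
      rw [pow_succ', mul_apply_eq_comp, hT, ih, smul_smul, pow_succ']
  have h1 := ((ha.smul_pow T).summable z).hasSum.mapL
    ((ev l).comp (ContinuousLinearMap.apply ℂ LaurentSpace b))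
  have h2 := ((ha.summable (z * c)).hasSum.smul_const (ev l b))
  refine HasSum.unique h1 (h2.congr_fun fun i => ?_)
  change ev l (z ^ i • a i • (T ^ i) b) = _
  rw [map_smul, map_smul, hTi, smul_smul, smul_smul, mul_pow, smul_eq_mul]
  congr 1
  ring

end Sequences

section Operators

set_option maxSynthPendingDepth 3

open Matrix Filter

/-- The matrix units. -/
def E11 : Mat2 := !![1, 0; 0, 0]
def E12 : Mat2 := !![0, 1; 0, 0]
def E21 : Mat2 := !![0, 0; 1, 0]
def E22 : Mat2 := !![0, 0; 0, 1]

/-- `L₀` (for `k = 1`) or its adjoint (for `k = -1`) as an operator on Laurent series. -/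
noncomputable def opFrame (k : ℤ) (A A' : Mat2) (z : ℂ) : LaurentOp :=
  opSer c0 (shift (-2 * k)) z + shift k * opSer (fun i => (i : ℂ) * c0 i) (shift (-2 * k)) z * constOp A
    - (2 : ℂ) • (shift (-k) * opSer c1 (shift (-2 * k)) z * constOp A')
    - (2 : ℂ) • (opSer (fun i => (i : ℂ) * c1 i) (shift (-2 * k)) z * constOp E22)

lemma differentiable_opFrame (k : ℤ) (A A' : Mat2) : Differentiable ℂ (opFrame k A A') := by
  have h1 := differentiable_opSer expDecay_c0 (shift (-2 * k))
  have h2 := differentiable_opSer expDecay_c1 (shift (-2 * k))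
  have h3 := differentiable_opSer expDecay_mul_c0 (shift (-2 * k))
  have h4 := differentiable_opSer expDecay_mul_c1 (shift (-2 * k))
  have e1 := ((h3.const_mul (shift k)).mul_const (constOp A))
  have e2 := (((h2.const_mul (shift (-k))).mul_const (constOp A')).const_smul (2 : ℂ))
  have e3 := ((h4.mul_const (constOp E22)).const_smul (2 : ℂ))
  exact ((h1.add e1).sub e2).sub e3

lemma opFrame_zero (k : ℤ) (A A' : Mat2) : opFrame k A A' 0 = 1 := by
  simp [opFrame, opSer_zero, c0, c1]

lemma ev_opFrame (k : ℤ) (A A' : Mat2) (z : ℂ) (l : Circle) (b : LaurentSpace) :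
    ev l (opFrame k A A' z b) = (g0 (z / ((l : ℂ) ^ k) ^ 2) • (1 : Mat2) +
      ((l : ℂ) ^ k * u0 (z / ((l : ℂ) ^ k) ^ 2)) • A - ((2 / (l : ℂ) ^ k) * g1 (z / ((l : ℂ) ^ k) ^ 2)) • A'
      - (2 * u1 (z / ((l : ℂ) ^ k) ^ 2)) • E22) *ᵥ ev l b := by
  have hl : (l : ℂ) ^ k ≠ 0 := zpow_ne_zero _ l.coe_ne_zero
  have hT := ev_shift l (-2 * k)
  have hx : z * (l : ℂ) ^ (-2 * k) = z / ((l : ℂ) ^ k) ^ 2 := by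
    rw [div_eq_mul_inv, neg_mul, _root_.zpow_neg, mul_comm 2 k, _root_.zpow_mul]
    norm_cast
  have s0 := ev_opSer expDecay_c0 hT z
  have s1 := ev_opSer expDecay_c1 hT z
  have s2 := ev_opSer expDecay_mul_c0 hT z
  have s3 := ev_opSer expDecay_mul_c1 hT z
  rw [hx] at s0 s1 s2 s3
  simp only [opFrame, _root_.sub_apply, _root_.add_apply,
    mul_apply_eq_comp, _root_.smul_apply, map_sub, map_add, map_smul, s0, s1, s2, s3,
    ev_shift, ev_constOp, Matrix.sub_mulVec, Matrix.add_mulVec, Matrix.smul_mulVec, one_mulVec,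
    smul_smul, _root_.zpow_neg, g0, g1, u0, u1]
  module

lemma pser_conj {a : ℕ → ℂ} (ha : ∀ i, conj (a i) = a i) (x : ℂ) :
    pser a (conj x) = conj (pser a x) := by
  unfold pser
  rw [Complex.conj_tsum]
  refine tsum_congr fun i => ?_
  simp [ha]

lemma conj_c0 (i : ℕ) : conj (c0 i) = c0 i := by simp [c0]
lemma conj_c1 (i : ℕ) : conj (c1 i) = c1 i := by simp [c1]

lemma ev_opFrame_one (z : ℂ) (l : Circle) (b : LaurentSpace) :
    ev l (opFrame 1 E12 E21 z b) = L0 z l *ᵥ ev l b := by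
  rw [ev_opFrame, L0_eq z l l.coe_ne_zero]
  congr 1
  ext i j
  fin_cases i <;> fin_cases j <;> simp [E12, E21, E22]

lemma ev_opFrame_neg_one (z : ℂ) (l : Circle) (b : LaurentSpace) :
    ev l (opFrame (-1) E21 E12 (conj z) b) = (L0 z l)ᴴ *ᵥ ev l b := by
  have hx : conj z / ((l : ℂ) ^ (-1 : ℤ)) ^ 2 = conj (z / (l : ℂ) ^ 2) := by
    simp [← Circle.coe_inv_eq_conj]
  rw [ev_opFrame, L0_eq z l l.coe_ne_zero, hx]
  have e0 : g0 (conj (z / (l : ℂ) ^ 2)) = conj (g0 (z / (l : ℂ) ^ 2)) := pser_conj conj_c0 _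
  have e1 : g1 (conj (z / (l : ℂ) ^ 2)) = conj (g1 (z / (l : ℂ) ^ 2)) := pser_conj conj_c1 _
  have e2 : u0 (conj (z / (l : ℂ) ^ 2)) = conj (u0 (z / (l : ℂ) ^ 2)) :=
    pser_conj (fun i => by simp [conj_c0]) _
  have e3 : u1 (conj (z / (l : ℂ) ^ 2)) = conj (u1 (z / (l : ℂ) ^ 2)) :=
    pser_conj (fun i => by simp [conj_c1]) _
  rw [e0, e1, e2, e3]
  congr 1
  ext i j
  fin_cases i <;> fin_cases j <;> simp [E12, E21, E22, ← Circle.coe_inv_eq_conj]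

/-- `s = -a - t - t̄`, where `t = log z`. -/
noncomputable def sVal (a : ℝ) (z : ℂ) : ℝ := -a - 2 * (Complex.log z).re

/-- The plus factor for the leading part `γ₀⁻¹ e^{tN/λ}`, and its inverse. -/
noncomputable def leadB (s : ℝ) (l : ℂ) : Mat2 := !![(√s : ℂ), -l / (√s : ℂ); 0, (√s : ℂ)⁻¹]
noncomputable def leadBinv (s : ℝ) (l : ℂ) : Mat2 := !![(√s : ℂ)⁻¹, l / (√s : ℂ); 0, (√s : ℂ)]

/-- The loop `B₀ L₀ B₀⁻¹`, close to the identity for small `z`. -/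
noncomputable def loopX (a : ℝ) (z : ℂ) (l : Circle) : Mat2 :=
  leadB (sVal a z) l * L0 z l * leadBinv (sVal a z) l

/-- The hermitian loop to be factorized. -/
noncomputable def loopH (a : ℝ) (z : ℂ) (l : Circle) : Mat2 := (loopX a z l)ᴴ * D * loopX a z l

noncomputable def opX (a : ℝ) (z : ℂ) : LaurentOp :=
  1 + (constOp E11 + (sVal a z : ℂ)⁻¹ • (constOp E22 - shift 1 * constOp E12)) *
    (opFrame 1 E12 E21 z - 1) * (constOp E11 + shift 1 * constOp E12 + (sVal a z : ℂ) • constOp E22)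

noncomputable def opXstar (a : ℝ) (z : ℂ) : LaurentOp :=
  1 + (constOp E11 + shift (-1) * constOp E21 + (sVal a z : ℂ) • constOp E22) *
    (opFrame (-1) E21 E12 (conj z) - 1) *
    (constOp E11 + (sVal a z : ℂ)⁻¹ • (constOp E22 - shift (-1) * constOp E21))

lemma sqrt_ofReal_mul_self {s : ℝ} (hs : 0 < s) : (√s : ℂ) * (√s : ℂ) = s := by
  rw [← Complex.ofReal_mul, Real.mul_self_sqrt hs.le]

lemma sqrt_ofReal_ne_zero {s : ℝ} (hs : 0 < s) : (√s : ℂ) ≠ 0 :=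
  Complex.ofReal_ne_zero.2 (Real.sqrt_pos.2 hs).ne'

lemma leadB_mul_leadBinv {s : ℝ} (hs : 0 < s) (l : ℂ) : leadB s l * leadBinv s l = 1 := by
  have := sqrt_ofReal_ne_zero hs
  rw [leadB, leadBinv, Matrix.one_fin_two]
  ext i j
  fin_cases i <;> fin_cases j <;> simp [this]
  field_simp
  ring

lemma leadB_conj_eq {s : ℝ} (hs : 0 < s) (l : ℂ) (Y : Mat2) : leadB s l * Y * leadBinv s l =
    (E11 + (s : ℂ)⁻¹ • (E22 - l • E12)) * Y * (E11 + l • E12 + (s : ℂ) • E22) := by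
  have h0 := sqrt_ofReal_ne_zero hs
  have h1 : leadB s l = (√s : ℂ) • (E11 + (s : ℂ)⁻¹ • (E22 - l • E12)) := by
    rw [← sqrt_ofReal_mul_self hs]
    ext i j
    fin_cases i <;> fin_cases j <;> simp [leadB, E11, E12, E22] <;> field_simp
  have h2 : leadBinv s l = (√s : ℂ)⁻¹ • (E11 + l • E12 + (s : ℂ) • E22) := by
    rw [← sqrt_ofReal_mul_self hs]
    ext i j
    fin_cases i <;> fin_cases j <;> simp [leadBinv, E11, E12, E22] <;> field_simp
  rw [h1, h2, Matrix.smul_mul, Matrix.smul_mul, Matrix.mul_smul, smul_smul, mul_inv_cancel₀ h0, one_smul]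

lemma loopX_eq {a : ℝ} {z : ℂ} (hs : 0 < sVal a z) (l : Circle) : loopX a z l =
    1 + (E11 + (sVal a z : ℂ)⁻¹ • (E22 - (l : ℂ) • E12)) * (L0 z l - 1) *
      (E11 + (l : ℂ) • E12 + (sVal a z : ℂ) • E22) := by
  rw [← leadB_conj_eq hs, mul_sub, sub_mul, mul_one, leadB_mul_leadBinv hs, loopX]
  abel

lemma ev_opX {a : ℝ} {z : ℂ} (hs : 0 < sVal a z) (l : Circle) (b : LaurentSpace) :
    ev l (opX a z b) = loopX a z l *ᵥ ev l b := by
  rw [loopX_eq hs]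
  simp only [opX, _root_.sub_apply, _root_.add_apply,
    mul_apply_eq_comp, _root_.smul_apply, map_sub, map_add, map_smul,
    ev_shift, ev_constOp, ev_opFrame_one, Matrix.sub_mulVec, Matrix.add_mulVec, Matrix.smul_mulVec,
    one_mulVec, one_apply_eq_self, zpow_one, ← Matrix.mulVec_mulVec, Matrix.mulVec_add,
    Matrix.mulVec_sub, Matrix.mulVec_smul]
  module

lemma loopX_star_eq {a : ℝ} {z : ℂ} (hs : 0 < sVal a z) (l : Circle) : (loopX a z l)ᴴ =
    1 + (E11 + (l : ℂ)⁻¹ • E21 + (sVal a z : ℂ) • E22) * ((L0 z l)ᴴ - 1) *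
      (E11 + (sVal a z : ℂ)⁻¹ • (E22 - (l : ℂ)⁻¹ • E21)) := by
  have h11 : E11ᴴ = E11 := by ext i j; fin_cases i <;> fin_cases j <;> simp [E11]
  have h12 : E12ᴴ = E21 := by ext i j; fin_cases i <;> fin_cases j <;> simp [E12, E21]
  have h22 : E22ᴴ = E22 := by ext i j; fin_cases i <;> fin_cases j <;> simp [E22]
  have hl : star (l : ℂ) = (l : ℂ)⁻¹ := by rw [← Circle.coe_inv, Circle.coe_inv_eq_conj]; rfl
  rw [loopX_eq hs]
  simp only [conjTranspose_add, conjTranspose_mul, conjTranspose_sub, conjTranspose_smul,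
    conjTranspose_one, h11, h12, h22, hl, star_inv₀, Matrix.mul_assoc]
  simp

lemma ev_opXstar {a : ℝ} {z : ℂ} (hs : 0 < sVal a z) (l : Circle) (b : LaurentSpace) :
    ev l (opXstar a z b) = (loopX a z l)ᴴ *ᵥ ev l b := by
  rw [loopX_star_eq hs]
  simp only [opXstar, _root_.sub_apply, _root_.add_apply,
    mul_apply_eq_comp, _root_.smul_apply, map_sub, map_add, map_smul,
    ev_shift, ev_constOp, ev_opFrame_neg_one, Matrix.sub_mulVec, Matrix.add_mulVec,
    Matrix.smul_mulVec, one_mulVec, one_apply_eq_self, _root_.zpow_neg, zpow_one,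
    ← Matrix.mulVec_mulVec, Matrix.mulVec_add, Matrix.mulVec_sub, Matrix.mulVec_smul]
  module

/-- Multiplication by `D H`. -/
noncomputable def opM (a : ℝ) (z : ℂ) : LaurentOp :=
  constOp D * opXstar a z * constOp D * opX a z

lemma ev_opM {a : ℝ} {z : ℂ} (hs : 0 < sVal a z) (l : Circle) (b : LaurentSpace) :
    ev l (opM a z b) = (D * loopH a z l) *ᵥ ev l b := by
  simp only [opM, mul_apply_eq_comp, ev_constOp, ev_opX hs, ev_opXstar hs, loopH,
    Matrix.mulVec_mulVec, Matrix.mul_assoc]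

/-- The operator of the projected equation. -/
noncomputable def opT (a : ℝ) (z : ℂ) : LaurentOp := 1 + holPart * (opM a z - 1)

/-- The columns of the solution, and the solution, of the Birkhoff problem. -/
noncomputable def solCol (a : ℝ) (z : ℂ) (j : Fin 2) : LaurentSpace :=
  Ring.inverse (opT a z) (constVec (Pi.single j 1))

noncomputable def solP (a : ℝ) (z : ℂ) (m : ℂ) : Mat2 :=
  Matrix.of fun i j => evp m (solCol a z j) i

noncomputable def solQ (a : ℝ) (z : ℂ) (m : ℂ) : Mat2 :=
  Matrix.of fun i j => evp m (reflect (opM a z (solCol a z i))) j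

lemma differentiableOn_evp_apply (b : LaurentSpace) (i : Fin 2) :
    DifferentiableOn ℂ (fun m => evp m b i) (Metric.ball 0 2) := by
  have h := differentiableOn_evp.clm_apply (differentiableOn_const b)
  exact differentiableOn_pi.1 h i

lemma isBirkhoff_sol {a : ℝ} {z : ℂ} (hs : 0 < sVal a z) (hu : IsUnit (opT a z)) :
    IsBirkhoff (loopH a z) (solP a z) (solQ a z) := by
  have hsol : ∀ j, (∀ n < 0, solCol a z j n = 0) ∧ (∀ n > 0, opM a z (solCol a z j) n = 0) ∧
      opM a z (solCol a z j) 0 = Pi.single j 1 := by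
    intro j
    have h : opT a z (solCol a z j) = constVec (Pi.single j 1) := by
      rw [solCol, ← mul_apply_eq_comp, Ring.mul_inverse_cancel _ hu, one_apply_eq_self]
    exact projected_equation (M := opM a z) (p := solCol a z j) h
  refine ⟨fun i j => differentiableOn_evp_apply _ _, fun i j => differentiableOn_evp_apply _ _, ?_,
    fun l => ?_⟩
  · ext i j
    simp only [solQ, Matrix.of_apply, evp_zero, reflect_apply, neg_zero, (hsol i).2.2]
    by_cases h : i = j
    · subst h; simp
    · simp [h, Ne.symm h]
  · ext i j
    have h1 := ev_opM hs l (solCol a z j)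
    rw [ev_eq_evp l (hsol j).1] at h1
    have h2 : star (ev l (opM a z (solCol a z j))) = evp l (reflect (opM a z (solCol a z j))) := by
      rw [star_ev, ev_eq_evp]
      intro n hn
      rw [reflect_apply, (hsol j).2.1 _ (by omega), star_zero]
    rw [conjTranspose_apply]
    simp only [solQ, Matrix.of_apply, ← h2, h1]
    fin_cases i <;> simp [Matrix.mul_apply, solP]

end Operators

section Smoothness

set_option maxSynthPendingDepth 3

open Matrix Filter Asymptotics

lemma sVal_eq (a : ℝ) (z : ℂ) : sVal a z = -a - 2 * Real.log ‖z‖ := by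
  rw [sVal, Complex.log_re]

lemma tendsto_sVal (a : ℝ) : Tendsto (sVal a) (𝓝[≠] 0) atTop := by
  have h1 : Tendsto (fun z : ℂ => Real.log ‖z‖) (𝓝[≠] 0) atBot :=
    Real.tendsto_log_nhdsGT_zero.comp tendsto_norm_nhdsNE_zero
  have h2 := tendsto_atTop_add_const_left _ (-a) (h1.const_mul_atBot_of_neg (r := -2) (by norm_num))
  refine h2.congr fun z => ?_
  rw [sVal_eq]
  ring

lemma tendsto_sVal_mul (a : ℝ) :
    Tendsto (fun z : ℂ => (sVal a z : ℂ) * z) (𝓝[≠] 0) (𝓝 0) := by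
  rw [tendsto_zero_iff_norm_tendsto_zero]
  have h : Continuous fun x : ℝ => |-a * x - 2 * (x * Real.log x)| := by
    have := Real.continuous_mul_log
    fun_prop
  have h2 := ((h.comp (continuous_norm (E := ℂ))).tendsto 0).mono_left
    (nhdsWithin_le_nhds (s := {0}ᶜ))
  simp only [Function.comp_apply, norm_zero, Real.log_zero, mul_zero, sub_zero, abs_zero] at h2
  refine h2.congr fun z => ?_
  rw [norm_mul, Complex.norm_real, Real.norm_eq_abs, sVal_eq]
  change |-a * ‖z‖ - 2 * (‖z‖ * Real.log ‖z‖)| = _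
  rw [show -a * ‖z‖ - 2 * (‖z‖ * Real.log ‖z‖) = (-a - 2 * Real.log ‖z‖) * ‖z‖ by ring, abs_mul,
    abs_norm]

lemma tendsto_sVal_inv (a : ℝ) : Tendsto (fun z : ℂ => (sVal a z : ℂ)⁻¹) (𝓝[≠] 0) (𝓝 0) := by
  have := (Complex.continuous_ofReal.tendsto 0).comp (tendsto_inv_atTop_zero.comp (tendsto_sVal a))
  simpa [Function.comp_def] using this

section

variable {Y : ℂ → LaurentOp}

lemma tendsto_of_isBigO (hY : Y =O[𝓝 0] fun z => z) : Tendsto Y (𝓝[≠] 0) (𝓝 0) :=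
  (hY.mono nhdsWithin_le_nhds).trans_tendsto (tendsto_id.mono_left nhdsWithin_le_nhds)

lemma tendsto_sVal_smul (a : ℝ) (hY : Y =O[𝓝 0] fun z => z) :
    Tendsto (fun z => (sVal a z : ℂ) • Y z) (𝓝[≠] 0) (𝓝 0) :=
  ((isBigO_refl (fun z => (sVal a z : ℂ)) (𝓝[≠] 0)).smul (hY.mono nhdsWithin_le_nhds)).trans_tendsto
    (tendsto_sVal_mul a)

lemma tendsto_bounded_factor (a : ℝ) (A A' : LaurentOp) :
    Tendsto (fun z : ℂ => A + (sVal a z : ℂ)⁻¹ • A') (𝓝[≠] 0) (𝓝 A) := by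
  simpa using (tendsto_const_nhds (x := A)).add ((tendsto_sVal_inv a).smul_const A')

lemma isBigO_opFrame (k : ℤ) (A A' : Mat2) :
    (fun z => opFrame k A A' z - 1) =O[𝓝 0] fun z => z := by
  have := (differentiable_opFrame k A A' 0).isBigO_sub
  simpa [opFrame_zero] using this

lemma isBigO_opFrame_conj (k : ℤ) (A A' : Mat2) :
    (fun z => opFrame k A A' (conj z) - 1) =O[𝓝 0] fun z => z := by
  have hc : Tendsto (fun z : ℂ => conj z) (𝓝 0) (𝓝 0) := by
    simpa using (Complex.continuous_conj.tendsto 0)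
  refine ((isBigO_opFrame k A A').comp_tendsto hc).trans ?_
  exact IsBigO.of_bound 1 (Eventually.of_forall fun z => by simp)

end

lemma tendsto_opX (a : ℝ) : Tendsto (opX a) (𝓝[≠] 0) (𝓝 1) := by
  have hY := isBigO_opFrame 1 E12 E21
  have h1 := tendsto_bounded_factor a (constOp E11) (constOp E22 - shift 1 * constOp E12)
  have h2 := (tendsto_of_isBigO hY).mul_const (constOp E11 + shift 1 * constOp E12)
  have h3 := (tendsto_sVal_smul a hY).mul_const (constOp E22)
  have := (h1.mul (h2.add h3)).const_add 1
  simp only [zero_mul, add_zero, mul_zero] at this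
  refine this.congr fun z => ?_
  rw [opX, mul_assoc, mul_add (opFrame 1 E12 E21 z - 1) (_ + _), mul_smul_comm, smul_mul_assoc]

lemma tendsto_opXstar (a : ℝ) : Tendsto (opXstar a) (𝓝[≠] 0) (𝓝 1) := by
  have hY := isBigO_opFrame_conj (-1) E21 E12
  have h1 := tendsto_bounded_factor a (constOp E11) (constOp E22 - shift (-1) * constOp E21)
  have h2 := (tendsto_of_isBigO hY).const_mul (constOp E11 + shift (-1) * constOp E21)
  have h3 := (tendsto_sVal_smul a hY).const_mul (constOp E22)
  have := ((h2.add h3).mul h1).const_add 1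
  simp only [zero_mul, add_zero, mul_zero] at this
  refine this.congr fun z => ?_
  rw [opXstar, add_mul (constOp E11 + shift (-1) * constOp E21), mul_smul_comm, smul_mul_assoc]

lemma constOp_D_mul_self : constOp D * constOp D = 1 := by
  ext b n : 2
  simp only [mul_apply_eq_comp, constOp_apply, Matrix.mulVec_mulVec, D_mul_D, one_mulVec,
    one_apply_eq_self]

lemma tendsto_opT (a : ℝ) : Tendsto (opT a) (𝓝[≠] 0) (𝓝 1) := by
  have h : Tendsto (opM a) (𝓝[≠] 0) (𝓝 1) := by
    have := (((tendsto_opXstar a).const_mul (constOp D)).mul_const (constOp D)).mul (tendsto_opX a)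
    rw [mul_one, mul_one, constOp_D_mul_self] at this
    exact this
  have := ((h.sub_const 1).const_mul holPart).const_add 1
  rw [sub_self, mul_zero, add_zero] at this
  exact this

lemma tendsto_inverse_opT (a : ℝ) : Tendsto (fun z => Ring.inverse (opT a z)) (𝓝[≠] 0) (𝓝 1) := by
  have h := (NormedRing.inverse_continuousAt (1 : LaurentOpˣ)).tendsto
  simp only [Units.val_one, Ring.inverse_one] at h
  exact h.comp (tendsto_opT a)

lemma eventually_isUnit_opT (a : ℝ) : ∀ᶠ z in 𝓝[≠] 0, IsUnit (opT a z) :=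
  (tendsto_opT a).eventually (Units.nhds (1 : LaurentOpˣ))

lemma tendsto_solP_zero (a : ℝ) : Tendsto (fun z => (solP a z 0 0 0).re) (𝓝[≠] 0) (𝓝 1) := by
  have h : Continuous fun T : LaurentOp => (T (constVec (Pi.single 0 1)) 0 0).re := by
    have h1 : Continuous fun T : LaurentOp => (BoundedContinuousFunction.evalCLM ℂ (0 : ℤ) :
        LaurentSpace →L[ℂ] (Fin 2 → ℂ)) (T (constVec (Pi.single 0 1))) := by fun_prop
    exact Complex.continuous_re.comp ((continuous_apply 0).comp h1)
  have h2 := (h.tendsto 1).comp (tendsto_inverse_opT a)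
  have h3 : ((1 : LaurentOp) (constVec (Pi.single 0 1)) 0 0).re = 1 := by
    simp [constVec_apply]
  rw [h3] at h2
  refine h2.congr fun z => ?_
  simp only [solP, Matrix.of_apply, evp_zero, solCol, Function.comp_apply]

/-! ### Smooth dependence on the parameter -/

lemma contDiffAt_sVal (a : ℝ) {z : ℂ} (hz : z ∈ Complex.slitPlane) :
    ContDiffAt ℝ ∞ (sVal a) z := by
  have h := (Complex.contDiffAt_log (n := ∞) hz).restrict_scalars ℝ
  have h2 := Complex.reCLM.contDiff.contDiffAt.comp z h
  exact contDiffAt_const.sub (contDiffAt_const.mul h2)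

lemma contDiffAt_sVal_ofReal (a : ℝ) {z : ℂ} (hz : z ∈ Complex.slitPlane) :
    ContDiffAt ℝ ∞ (fun z => (sVal a z : ℂ)) z :=
  Complex.ofRealCLM.contDiff.contDiffAt.comp z (contDiffAt_sVal a hz)

lemma contDiffAt_smul_op {c : ℂ → ℂ} {z : ℂ} (hc : ContDiffAt ℝ ∞ c z) (A : LaurentOp) :
    ContDiffAt ℝ ∞ (fun z => c z • A) z := by
  have h : ContDiff ℂ ∞ fun c : ℂ => c • A := contDiff_id.smul contDiff_const
  exact (h.restrict_scalars ℝ).contDiffAt.comp z hc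

lemma contDiff_opFrame (k : ℤ) (A A' : Mat2) : ContDiff ℝ ∞ (opFrame k A A') :=
  (differentiable_opFrame k A A').contDiff.restrict_scalars ℝ

lemma contDiffAt_opT (a : ℝ) {z : ℂ} (hz : z ∈ Complex.slitPlane) (hs : 0 < sVal a z) :
    ContDiffAt ℝ ∞ (opT a) z := by
  have s1 := contDiffAt_sVal_ofReal a hz
  have s2 := s1.inv (Complex.ofReal_ne_zero.2 hs.ne')
  have f1 := (contDiff_opFrame 1 E12 E21).contDiffAt (x := z)
  have f2 := ((contDiff_opFrame (-1) E21 E12).comp Complex.conjCLE.contDiff).contDiffAt (x := z)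
  have hX : ContDiffAt ℝ ∞ (opX a) z :=
    contDiffAt_const.add (((contDiffAt_const.add (contDiffAt_smul_op s2 _)).mul
      (f1.sub contDiffAt_const)).mul (contDiffAt_const.add (contDiffAt_smul_op s1 _)))
  have hXs : ContDiffAt ℝ ∞ (opXstar a) z :=
    contDiffAt_const.add (((contDiffAt_const.add (contDiffAt_smul_op s1 _)).mul
      (f2.sub contDiffAt_const)).mul (contDiffAt_const.add (contDiffAt_smul_op s2 _)))
  have hM : ContDiffAt ℝ ∞ (opM a) z := ((contDiffAt_const.mul hXs).mul contDiffAt_const).mul hX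
  exact contDiffAt_const.add (contDiffAt_const.mul (hM.sub contDiffAt_const))

lemma contDiffAt_solCol (a : ℝ) {z : ℂ} (hz : z ∈ Complex.slitPlane) (hs : 0 < sVal a z)
    (hu : IsUnit (opT a z)) (j : Fin 2) : ContDiffAt ℝ ∞ (fun z => solCol a z j) z := by
  obtain ⟨u, hu⟩ := hu
  have h1 := contDiffAt_ringInverse ℝ (n := ∞) u
  rw [hu] at h1
  have h2 : ContDiffAt ℝ ∞ (fun z => Ring.inverse (opT a z)) z := h1.comp z (contDiffAt_opT a hz hs)
  have h3 : ContDiff ℂ ∞ fun T : LaurentOp => T (constVec (Pi.single j 1)) :=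
    (ContinuousLinearMap.apply ℂ LaurentSpace (constVec (Pi.single j 1))).contDiff
  exact (h3.restrict_scalars ℝ).contDiffAt.comp z h2

lemma contDiff_circle_exp : ContDiff ℝ ∞ fun θ : ℝ => (Circle.exp θ : ℂ) := by
  simp only [Circle.coe_exp]
  exact ((Complex.contDiff_exp (𝕜 := ℝ))).comp
    (Complex.ofRealCLM.contDiff.mul contDiff_const)

lemma contDiffAt_solP (a : ℝ) {z : ℂ} (hz : z ∈ Complex.slitPlane) (hs : 0 < sVal a z)
    (hu : IsUnit (opT a z)) {m : ℂ} (hm : m ∈ Metric.ball (0 : ℂ) 2) (i j : Fin 2) :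
    ContDiffAt ℝ ∞ (fun p : ℂ × ℂ => solP a p.1 p.2 i j) (z, m) := by
  have h1 : ContDiffAt ℝ ∞ (fun p : ℂ × ℂ => solCol a p.1 j) (z, m) :=
    (contDiffAt_solCol a hz hs hu j).comp (z, m) contDiffAt_fst
  have h2 : ContDiffAt ℝ ∞ (fun p : ℂ × ℂ => evp p.2) (z, m) :=
    (((differentiableOn_evp.contDiffOn Metric.isOpen_ball).contDiffAt
      (Metric.isOpen_ball.mem_nhds hm)).restrict_scalars ℝ).comp (z, m) contDiffAt_snd
  have h3 : ContDiff ℂ ∞ fun q : (LaurentSpace →L[ℂ] (Fin 2 → ℂ)) × LaurentSpace => q.1 q.2 :=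
    contDiff_fst.clm_apply contDiff_snd
  have h4 := (h3.restrict_scalars ℝ).contDiffAt.comp (z, m) (h2.prodMk h1)
  exact contDiffAt_pi.1 h4 i

end Smoothness

section Factorization

open Matrix

lemma star_circle (l : Circle) : star (l : ℂ) = (l : ℂ)⁻¹ := by
  rw [← Circle.coe_inv, Circle.coe_inv_eq_conj]
  rfl

lemma conj_circle (l : Circle) : conj (l : ℂ) = (l : ℂ)⁻¹ := star_circle l

lemma circle_mem_closedBall (l : Circle) : (l : ℂ) ∈ Metric.closedBall (0 : ℂ) 1 := by
  simp [Circle.norm_coe]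

lemma dEps_conjTranspose (ε : Circle) : (dEps ε)ᴴ = !![1, 0; 0, (ε : ℂ)⁻¹] := by
  ext i j
  fin_cases i <;> fin_cases j <;> simp [dEps, conj_circle]

lemma dEps_conjTranspose_mul (ε : Circle) : (dEps ε)ᴴ * dEps ε = 1 := by
  rw [dEps_conjTranspose, dEps, Matrix.one_fin_two]
  simp

lemma dEps_mul_conjTranspose (ε : Circle) : dEps ε * (dEps ε)ᴴ = 1 :=
  mul_eq_one_comm.1 (dEps_conjTranspose_mul ε)

lemma dEps_inv (ε : Circle) : (dEps ε)⁻¹ = (dEps ε)ᴴ :=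
  Matrix.inv_eq_left_inv (dEps_conjTranspose_mul ε)

lemma dEps_neg_one : dEps (-1) = D := by simp [dEps, D]

lemma dEps_mul_D (ε : Circle) : dEps ε * D = D * dEps ε := by simp [dEps, D]

/-- Conjugation by `d(ε)` on matrix entries. -/
lemma dEps_conj (ε : Circle) (A : Mat2) : (dEps ε)ᴴ * A * dEps ε =
    !![A 0 0, ε * A 0 1; (ε : ℂ)⁻¹ * A 1 0, A 1 1] := by
  rw [dEps_conjTranspose, dEps]
  conv_lhs => rw [Matrix.eta_fin_two A, Matrix.mul_fin_two, Matrix.mul_fin_two]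
  ext i j
  fin_cases i <;> fin_cases j <;> simp
  · ring
  · field_simp

lemma dEps_conj_mul (ε : Circle) (A A' : Mat2) : ((dEps ε)ᴴ * A * dEps ε) * ((dEps ε)ᴴ * A' * dEps ε) =
    (dEps ε)ᴴ * (A * A') * dEps ε := by
  calc _ = (dEps ε)ᴴ * A * (dEps ε * (dEps ε)ᴴ) * A' * dEps ε := by simp only [Matrix.mul_assoc]
    _ = _ := by rw [dEps_mul_conjTranspose]; simp only [Matrix.mul_assoc, Matrix.one_mul]

lemma dEps_conj_adjugate (ε : Circle) (A : Mat2) :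
    ((dEps ε)ᴴ * A * dEps ε).adjugate = (dEps ε)ᴴ * A.adjugate * dEps ε := by
  rw [dEps_conj, dEps_conj, adjugate_fin_two, adjugate_fin_two]
  simp

lemma dEps_conj_D (ε : Circle) : (dEps ε)ᴴ * D * dEps ε = D := by
  rw [dEps_conj]; simp [D]

lemma dEps_conj_conjTranspose (ε : Circle) (A : Mat2) :
    ((dEps ε)ᴴ * A * dEps ε)ᴴ = (dEps ε)ᴴ * Aᴴ * dEps ε := by
  simp only [conjTranspose_mul, conjTranspose_conjTranspose, Matrix.mul_assoc]

lemma sVal_rotate (a : ℝ) (ε : Circle) (z : ℂ) : sVal a ((ε : ℂ) ^ 2 * z) = sVal a z := by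
  simp [sVal_eq, Circle.norm_coe]

lemma leadB_rotate (s : ℝ) (ε : Circle) (l : ℂ) :
    leadB s (ε * l) = (dEps ε)ᴴ * leadB s l * dEps ε := by
  rw [dEps_conj]
  simp [leadB]
  ring

lemma leadBinv_rotate (s : ℝ) (ε : Circle) (l : ℂ) :
    leadBinv s (ε * l) = (dEps ε)ᴴ * leadBinv s l * dEps ε := by
  rw [dEps_conj]
  simp [leadBinv]
  ring

lemma L0_rotate (ε l : Circle) (z : ℂ) :
    L0 ((ε : ℂ) ^ 2 * z) (ε * l : Circle) = (dEps ε)ᴴ * L0 z l * dEps ε := by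
  have hl := l.coe_ne_zero
  have he := ε.coe_ne_zero
  have hx : (ε : ℂ) ^ 2 * z / ((ε * l : Circle) : ℂ) ^ 2 = z / (l : ℂ) ^ 2 := by
    rw [Circle.coe_mul]
    field_simp
  rw [dEps_conj, L0_eq _ _ (Circle.coe_ne_zero _), L0_eq z l hl, hx, Circle.coe_mul]
  ext i j
  fin_cases i <;> fin_cases j <;> simp <;> field_simp

lemma loopX_rotate (a : ℝ) (ε l : Circle) (z : ℂ) :
    loopX a ((ε : ℂ) ^ 2 * z) (ε * l) = (dEps ε)ᴴ * loopX a z l * dEps ε := by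
  rw [loopX, L0_rotate, sVal_rotate, Circle.coe_mul, leadB_rotate, leadBinv_rotate, dEps_conj_mul,
    dEps_conj_mul, loopX]

lemma loopH_rotate (a : ℝ) (ε l : Circle) (z : ℂ) :
    loopH a ((ε : ℂ) ^ 2 * z) (ε * l) = (dEps ε)ᴴ * loopH a z l * dEps ε := by
  rw [loopH, loopX_rotate, dEps_conj_conjTranspose]
  nth_rewrite 1 [← dEps_conj_D ε]
  rw [dEps_conj_mul, dEps_conj_mul, loopH]

lemma loopH_conjTranspose (a : ℝ) (z : ℂ) (l : Circle) : (loopH a z l)ᴴ = loopH a z l := by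
  simp only [loopH, conjTranspose_mul, conjTranspose_conjTranspose, D_conjTranspose, Matrix.mul_assoc]

lemma det_leadB {s : ℝ} (hs : 0 < s) (l : ℂ) : (leadB s l).det = 1 := by
  simp [leadB, sqrt_ofReal_ne_zero hs]

lemma det_loopH {a : ℝ} {z : ℂ} (hs : 0 < sVal a z) (l : Circle) : (loopH a z l).det = -1 := by
  have h : (leadBinv (sVal a z) l).det = 1 := by
    simp [leadBinv, sqrt_ofReal_ne_zero hs]
  have hX : (loopX a z l).det = 1 := by
    rw [loopX, det_mul, det_mul, det_leadB hs, h, det_L0 _ _ l.coe_ne_zero]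
    simp
  rw [loopH, det_mul, det_mul, det_conjTranspose, hX, det_D]
  simp

lemma eq_neg_one_mul_of_coe_eq_neg {l m : Circle} (h : (m : ℂ) = -l) : m = -1 * l := by
  ext
  simp [h]

/-- A family that is homogeneous for `ε = -1` is twisted. -/
lemma isTwisted_iff (γ : Circle → Mat2) :
    IsTwisted γ ↔ ∀ l, γ (-1 * l) = (dEps (-1))ᴴ * γ l * dEps (-1) := by
  have hD : ∀ A A' : Mat2, D * A * D = A' ↔ A = D * A' * D := by
    intro A A'
    constructor <;> rintro rfl
    · rw [Matrix.mul_assoc, Matrix.mul_assoc, Matrix.mul_assoc, D_mul_D, Matrix.mul_one,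
        ← Matrix.mul_assoc, D_mul_D, Matrix.one_mul]
    · rw [Matrix.mul_assoc, Matrix.mul_assoc, Matrix.mul_assoc, D_mul_D, Matrix.mul_one,
        ← Matrix.mul_assoc, D_mul_D, Matrix.one_mul]
  rw [dEps_neg_one, D_conjTranspose]
  constructor
  · intro h l
    exact (hD _ _).1 (h l _ (by simp))
  · intro h l m hm
    rw [eq_neg_one_mul_of_coe_eq_neg hm]
    exact (hD _ _).2 (h l)

lemma IsTwisted.mul {γ δ : Circle → Mat2} (hγ : IsTwisted γ) (hδ : IsTwisted δ) :
    IsTwisted fun l => γ l * δ l := by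
  rw [isTwisted_iff] at *
  intro l
  simp only [hγ, hδ, dEps_conj_mul]

lemma IsTwisted.adjugate {γ : Circle → Mat2} (hγ : IsTwisted γ) :
    IsTwisted fun l => (γ l).adjugate := by
  rw [isTwisted_iff] at *
  intro l
  simp only [hγ, dEps_conj_adjugate]

lemma loopH_twisted (a : ℝ) (z : ℂ) (l m : Circle) (h : (m : ℂ) = -l) :
    D * loopH a z m * D = loopH a z l := by
  refine (isTwisted_iff (loopH a z)).2 (fun l => ?_) l m h
  simpa using loopH_rotate a (-1) l z

/-- The parameters for which the construction works. -/
structure Good (a : ℝ) (z : ℂ) : Prop where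
  slit : z ∈ Complex.slitPlane
  sVal_pos : 0 < sVal a z
  isUnit : IsUnit (opT a z)
  sol_pos : 0 < (solP a z 0 0 0).re

/-- The first diagonal entry of the solution of the Birkhoff problem, at `λ = 0`. -/
noncomputable def pVal (a : ℝ) (z : ℂ) : ℝ := (solP a z 0 0 0).re

/-- The normalized holomorphic factor, as a function on the disk. -/
noncomputable def facB (a : ℝ) (z : ℂ) (m : ℂ) : Mat2 :=
  !![(√(pVal a z) : ℂ), 0; 0, (√(pVal a z) : ℂ)⁻¹] * (solP a z m).adjugate * leadB (sVal a z) m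

variable {a : ℝ} {z : ℂ}

lemma Good.isBirkhoff (h : Good a z) : IsBirkhoff (loopH a z) (solP a z) (solQ a z) :=
  isBirkhoff_sol h.sVal_pos h.isUnit

lemma Good.det_solP (h : Good a z) : ∀ m ∈ Metric.closedBall (0 : ℂ) 1, (solP a z m).det = 1 :=
  h.isBirkhoff.det_eq_one (det_loopH h.sVal_pos)

lemma Good.solP_zero (h : Good a z) : solP a z 0 = !![(pVal a z : ℂ), 0; 0, (pVal a z : ℂ)⁻¹] :=
  h.isBirkhoff.left_zero (loopH_conjTranspose a z) (det_loopH h.sVal_pos) (loopH_twisted a z)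

lemma solP_rotate {ε : Circle} (h : Good a z) (h' : Good a ((ε : ℂ) ^ 2 * z)) :
    ∀ m ∈ Metric.closedBall (0 : ℂ) 1,
      solP a ((ε : ℂ) ^ 2 * z) (ε * m) = (dEps ε)ᴴ * solP a z m * dEps ε := by
  intro m hm
  have hrot := h'.isBirkhoff.rotate ε (dEps_conjTranspose_mul ε) (dEps_mul_D ε)
  have hHeq : (fun l => dEps ε * loopH a ((ε : ℂ) ^ 2 * z) (ε * l) * (dEps ε)ᴴ) = loopH a z := by
    funext l
    rw [loopH_rotate]
    calc _ = (dEps ε * (dEps ε)ᴴ) * loopH a z l * (dEps ε * (dEps ε)ᴴ) := by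
          simp only [Matrix.mul_assoc]
      _ = _ := by rw [dEps_mul_conjTranspose, Matrix.one_mul, Matrix.mul_one]
  rw [hHeq] at hrot
  rw [h.isBirkhoff.unique hrot (loopH_conjTranspose a z) (det_loopH h.sVal_pos) m hm]
  calc _ = ((dEps ε)ᴴ * dEps ε) * solP a ((ε : ℂ) ^ 2 * z) (ε * m) * ((dEps ε)ᴴ * dEps ε) := by
        rw [dEps_conjTranspose_mul, Matrix.one_mul, Matrix.mul_one]
    _ = _ := by simp only [Matrix.mul_assoc]

lemma pVal_rotate {ε : Circle} (h : Good a z) (h' : Good a ((ε : ℂ) ^ 2 * z)) :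
    pVal a ((ε : ℂ) ^ 2 * z) = pVal a z := by
  have := solP_rotate h h' 0 (by simp)
  rw [mul_zero, dEps_conj] at this
  simp [pVal, this]

lemma facB_rotate {ε : Circle} (h : Good a z) (h' : Good a ((ε : ℂ) ^ 2 * z)) (l : Circle) :
    facB a ((ε : ℂ) ^ 2 * z) (ε * l : Circle) = (dEps ε)ᴴ * facB a z l * dEps ε := by
  have hd : ∀ c : ℂ, !![c, 0; 0, c⁻¹] = (dEps ε)ᴴ * !![c, 0; 0, c⁻¹] * dEps ε := by
    intro c
    rw [dEps_conj]; simp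
  rw [facB, facB, sVal_rotate, pVal_rotate h h', Circle.coe_mul, solP_rotate h h' _ (circle_mem_closedBall l),
    leadB_rotate, dEps_conj_adjugate, hd, dEps_conj_mul, dEps_conj_mul, ← hd]

lemma Good.facB_twisted (h : Good a z) : IsTwisted fun l : Circle => facB a z l := by
  rw [isTwisted_iff]
  intro l
  have := facB_rotate (ε := -1) h (by simpa using h) l
  simpa using this

lemma Good.facB_zero (h : Good a z) : facB a z 0 =
    !![((√(sVal a z) * (√(pVal a z))⁻¹ : ℝ) : ℂ), 0; 0, ((√(sVal a z) * (√(pVal a z))⁻¹ : ℝ) : ℂ)⁻¹] := by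
  have hp : 0 < pVal a z := h.sol_pos
  have h0 := sqrt_ofReal_ne_zero hp
  rw [facB, h.solP_zero, leadB, adjugate_fin_two, ← sqrt_ofReal_mul_self hp]
  ext i j
  fin_cases i <;> fin_cases j <;> simp
  · field_simp
  · left
    field_simp

lemma Good.det_facB (h : Good a z) : ∀ m ∈ Metric.closedBall (0 : ℂ) 1, (facB a z m).det = 1 := by
  intro m hm
  have hp : 0 < pVal a z := h.sol_pos
  rw [facB, det_mul, det_mul, det_leadB h.sVal_pos, det_adjugate, h.det_solP m hm]
  simp [sqrt_ofReal_ne_zero hp]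

lemma Good.facB_hol (h : Good a z) : Hol (facB a z) := by
  refine ((hol_const _).mul h.isBirkhoff.hol_left.adjugate).mul fun i j => ?_
  fin_cases i <;> fin_cases j <;> simp [leadB]
  fun_prop

lemma Good.isDiskExtension (h : Good a z) :
    IsDiskExtension (fun l : Circle => facB a z l) (facB a z) where
  continuousOn i j := (h.facB_hol i j).continuousOn.mono (Metric.closedBall_subset_ball (by norm_num))
  differentiableOn i j := (h.facB_hol i j).mono (Metric.ball_subset_ball (by norm_num))
  det_eq_one := h.det_facB
  eq_on_circle _ := rfl

lemma Good.hasLeadingTerm (h : Good a z) : HasLeadingTerm (fun l : Circle => facB a z l)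
    !![((√(sVal a z) * (√(pVal a z))⁻¹ : ℝ) : ℂ), 0; 0, ((√(sVal a z) * (√(pVal a z))⁻¹ : ℝ) : ℂ)⁻¹] := by
  refine ⟨facB a z, h.isDiskExtension, fun i j => ?_⟩
  rw [← h.facB_zero]
  have := (((h.facB_hol i j) 0 (by simp)).differentiableAt
    (Metric.ball_mem_nhds 0 (by norm_num))).isBigO_sub
  simpa using this

lemma Good.facB_form (h : Good a z) (l : Circle) :
    (facB a z l)ᴴ * D * facB a z l =
      (leadB (sVal a z) l)ᴴ * loopH a z l * leadB (sVal a z) l := by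
  have hp : 0 < pVal a z := h.sol_pos
  have h0 := sqrt_ofReal_ne_zero hp
  set M : Mat2 := !![(√(pVal a z) : ℂ), 0; 0, (√(pVal a z) : ℂ)⁻¹] with hM
  have e1 : Mᴴ * D * M = (solP a z l)ᴴ * loopH a z l * solP a z l := by
    rw [h.isBirkhoff.conjTranspose_mul_eq (loopH_conjTranspose a z),
      (h.isBirkhoff.pairing h.isBirkhoff (loopH_conjTranspose a z)).1 l (circle_mem_closedBall l), h.solP_zero,
      ← sqrt_ofReal_mul_self hp]
    ext i j
    fin_cases i <;> fin_cases j <;> simp [hM, D, Matrix.mul_apply]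
  have e2 : solP a z l * (solP a z l).adjugate = 1 := by
    rw [mul_adjugate, h.det_solP l (circle_mem_closedBall l), one_smul]
  calc _ = (leadB (sVal a z) l)ᴴ * ((solP a z l).adjugateᴴ * (Mᴴ * D * M) * (solP a z l).adjugate) *
          leadB (sVal a z) l := by
        simp only [facB, ← hM, conjTranspose_mul, Matrix.mul_assoc]
    _ = (leadB (sVal a z) l)ᴴ * ((solP a z l * (solP a z l).adjugate)ᴴ * loopH a z l *
          (solP a z l * (solP a z l).adjugate)) * leadB (sVal a z) l := by
        rw [e1]
        simp only [conjTranspose_mul, Matrix.mul_assoc]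
    _ = _ := by
        rw [e2]; simp

lemma gamma0_inv (ha : 0 < a) (l : Circle) :
    (gamma0 a l)⁻¹ = !![(√a : ℂ), (l : ℂ) / (√a : ℂ); 0, (√a : ℂ)⁻¹] := by
  have h0 := sqrt_ofReal_ne_zero ha
  refine Matrix.inv_eq_right_inv ?_
  rw [gamma0, Matrix.one_fin_two]
  ext i j
  fin_cases i <;> fin_cases j <;> simp [h0]
  field_simp
  ring

/-- The unipotent factor `e^{tN/λ}`. -/
noncomputable def expN (t : ℂ) (l : Circle) : Mat2 := !![1, 0; t / l, 1]

lemma expN_add (t t' : ℂ) (l : Circle) : expN (t + t') l = expN t l * expN t' l := by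
  simp [expN, add_div]

lemma lead_form (ha : 0 < a) (hs : 0 < sVal a z) (l : Circle) :
    ((gamma0 a l)⁻¹ * expN (Complex.log z) l)ᴴ * D * ((gamma0 a l)⁻¹ * expN (Complex.log z) l) =
      -((leadB (sVal a z) l)ᴴ * D * leadB (sVal a z) l) := by
  have h0 := sqrt_ofReal_ne_zero ha
  have h1 := sqrt_ofReal_ne_zero hs
  have hl := l.coe_ne_zero
  have hN : (gamma0 a l)⁻¹ * expN (Complex.log z) l =
      !![(√a : ℂ) + Complex.log z / √a, l / √a; Complex.log z / (√a * l), (√a : ℂ)⁻¹] := by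
    rw [gamma0_inv ha, expN]
    ext i j
    fin_cases i <;> fin_cases j <;> simp
    field_simp
  have hsum : Complex.log z + conj (Complex.log z) = ((2 * (Complex.log z).re : ℝ) : ℂ) :=
    Complex.add_conj _
  have hsv : (sVal a z : ℂ) = -(√a : ℂ) * √a - (Complex.log z + conj (Complex.log z)) := by
    rw [hsum, neg_mul, sqrt_ofReal_mul_self ha, sVal]
    push_cast
    ring
  have hss := sqrt_ofReal_mul_self hs
  rw [hN, leadB, mul_D, mul_D]
  ext i j
  fin_cases i <;> fin_cases j <;> simp [Matrix.mul_apply, conj_circle]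
  · rw [hss, hsv]
    field_simp
    ring
  all_goals
    field_simp
    ring

end Factorization

section Frame

open Matrix

/-- The loop `γ₀⁻¹ L`. -/
noncomputable def frame (a : ℝ) (z : ℂ) (l : Circle) : Mat2 := (gamma0 a l)⁻¹ * L z l

/-- The inverse of `w`. -/
noncomputable def winv (l : Circle) : Mat2 := !![0, -(l : ℂ); (l : ℂ)⁻¹, 0]

/-- The `SU_{1,1}` factor. -/
noncomputable def facF (a : ℝ) (z : ℂ) (l : Circle) : Mat2 :=
  frame a z l * (facB a z l).adjugate * winv l

lemma winv_mul_w (l : Circle) : winv l * w l = 1 := by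
  have := l.coe_ne_zero
  rw [winv, w, Matrix.one_fin_two]
  simp [this]

lemma winv_form (l : Circle) : (winv l)ᴴ * D * winv l = -D := by
  have := l.coe_ne_zero
  rw [mul_D]
  ext i j
  fin_cases i <;> fin_cases j <;> simp [winv, Matrix.mul_apply, conj_circle, D, this]

lemma frame_eq (a : ℝ) (z : ℂ) (l : Circle) :
    frame a z l = (gamma0 a l)⁻¹ * expN (Complex.log z) l * L0 z l := by
  rw [frame, L, expN, Matrix.mul_assoc]

variable {a : ℝ} {z : ℂ}

lemma facF_mul_w (z : ℂ) (l : Circle) :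
    facF a z l * w l = frame a z l * (facB a z l).adjugate := by
  rw [facF, Matrix.mul_assoc, winv_mul_w, Matrix.mul_one]

lemma Good.adjugate_mul_facB (h : Good a z) (l : Circle) :
    (facB a z l).adjugate * facB a z l = 1 := by
  rw [adjugate_mul, h.det_facB l (circle_mem_closedBall l), one_smul]

lemma Good.facB_mul_adjugate (h : Good a z) (l : Circle) :
    facB a z l * (facB a z l).adjugate = 1 := by
  rw [mul_adjugate, h.det_facB l (circle_mem_closedBall l), one_smul]

lemma Good.frame_form (h : Good a z) (ha : 0 < a) (l : Circle) :
    (frame a z l)ᴴ * D * frame a z l = -((facB a z l)ᴴ * D * facB a z l) := by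
  have hX : loopX a z l * leadB (sVal a z) l = leadB (sVal a z) l * L0 z l := by
    rw [loopX, Matrix.mul_assoc, mul_eq_one_comm.1 (leadB_mul_leadBinv h.sVal_pos l), Matrix.mul_one]
  calc _ = (L0 z l)ᴴ * (((gamma0 a l)⁻¹ * expN (Complex.log z) l)ᴴ * D *
          ((gamma0 a l)⁻¹ * expN (Complex.log z) l)) * L0 z l := by
        rw [frame_eq]
        simp only [conjTranspose_mul, Matrix.mul_assoc]
    _ = -((leadB (sVal a z) l * L0 z l)ᴴ * D * (leadB (sVal a z) l * L0 z l)) := by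
        rw [lead_form ha h.sVal_pos]
        simp only [conjTranspose_mul, Matrix.mul_assoc, Matrix.neg_mul, Matrix.mul_neg]
    _ = _ := by
        rw [← hX, h.facB_form, loopH]
        simp only [conjTranspose_mul, Matrix.mul_assoc]

lemma Good.facF_form (h : Good a z) (ha : 0 < a) (l : Circle) :
    (facF a z l)ᴴ * D * facF a z l = D := by
  calc _ = (winv l)ᴴ * ((facB a z l).adjugateᴴ * ((frame a z l)ᴴ * D * frame a z l) *
          (facB a z l).adjugate) * winv l := by
        simp only [facF, conjTranspose_mul, Matrix.mul_assoc]
    _ = -((winv l)ᴴ * ((facB a z l * (facB a z l).adjugate)ᴴ * D *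
          (facB a z l * (facB a z l).adjugate)) * winv l) := by
        rw [h.frame_form ha]
        simp only [conjTranspose_mul, Matrix.mul_assoc, Matrix.neg_mul, Matrix.mul_neg]
    _ = _ := by
        rw [h.facB_mul_adjugate]
        simp [winv_form]

lemma det_gamma0 (ha : 0 < a) (l : Circle) : (gamma0 a l).det = 1 := by
  simp [gamma0, sqrt_ofReal_ne_zero ha]

lemma gamma0_mul_inv (ha : 0 < a) (l : Circle) : gamma0 a l * (gamma0 a l)⁻¹ = 1 :=
  Matrix.mul_nonsing_inv _ (by rw [det_gamma0 ha]; exact isUnit_one)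

lemma det_gamma0_inv (ha : 0 < a) (l : Circle) : ((gamma0 a l)⁻¹).det = 1 := by
  rw [gamma0_inv ha]
  simp [sqrt_ofReal_ne_zero ha]

lemma Good.det_facF (h : Good a z) (ha : 0 < a) (l : Circle) : (facF a z l).det = 1 := by
  have h1 : (expN (Complex.log z) l).det = 1 := by simp [expN]
  have h2 : (winv l).det = 1 := by simp [winv]
  rw [facF, frame_eq, det_mul, det_mul, det_mul, det_mul, h1, h2, det_gamma0_inv ha, det_adjugate,
    h.det_facB l (circle_mem_closedBall l), det_L0 z l l.coe_ne_zero]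
  simp

lemma Good.facF_mem_SU11 (h : Good a z) (ha : 0 < a) (l : Circle) : facF a z l ∈ SU11 := by
  refine ⟨h.det_facF ha l, ?_⟩
  have h1 : (facF a z l)ᴴ * (D * facF a z l * D) = 1 := by
    rw [← Matrix.mul_assoc, ← Matrix.mul_assoc, h.facF_form ha, D_mul_D]
  rw [Matrix.inv_eq_right_inv h1]
  simp only [Matrix.mul_assoc, D_mul_D, Matrix.mul_one]
  rw [← Matrix.mul_assoc, D_mul_D, Matrix.one_mul]

lemma gamma0_rotate (a : ℝ) (ε l : Circle) :
    gamma0 a (ε * l) = (dEps ε)ᴴ * gamma0 a l * dEps ε := by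
  rw [dEps_conj]
  simp [gamma0]
  ring

lemma gamma0_inv_rotate (ha : 0 < a) (ε l : Circle) :
    (gamma0 a (ε * l))⁻¹ = (dEps ε)ᴴ * (gamma0 a l)⁻¹ * dEps ε := by
  rw [dEps_conj, gamma0_inv ha, gamma0_inv ha]
  simp
  ring

lemma expN_rotate (t : ℂ) (ε l : Circle) : expN t (ε * l) = (dEps ε)ᴴ * expN t l * dEps ε := by
  rw [dEps_conj]
  simp [expN]
  ring

/-- The frame is homogeneous up to the monodromy of the logarithm. -/
lemma frame_rotate (ha : 0 < a) (ε l : Circle) (z : ℂ) :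
    frame a ((ε : ℂ) ^ 2 * z) (ε * l) = (dEps ε)ᴴ * ((gamma0 a l)⁻¹ *
      expN (Complex.log ((ε : ℂ) ^ 2 * z) - Complex.log z) l * gamma0 a l) * frame a z l * dEps ε := by
  have h0 := gamma0_mul_inv ha l
  rw [frame_eq, L0_rotate, gamma0_inv_rotate ha, expN_rotate, dEps_conj_mul, dEps_conj_mul]
  nth_rewrite 1 [← sub_add_cancel (Complex.log ((ε : ℂ) ^ 2 * z)) (Complex.log z)]
  rw [expN_add, frame_eq]
  calc _ = (dEps ε)ᴴ * ((gamma0 a l)⁻¹ * expN (Complex.log ((ε : ℂ) ^ 2 * z) - Complex.log z) l * 1 *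
        expN (Complex.log z) l * L0 z l) * dEps ε := by
        simp only [Matrix.mul_assoc, Matrix.one_mul]
    _ = _ := by
        rw [← h0]
        simp only [Matrix.mul_assoc]

lemma isTwisted_frame (ha : 0 < a) (z : ℂ) : IsTwisted (frame a z) := by
  rw [isTwisted_iff]
  intro l
  have h0 : (gamma0 a l)⁻¹ * gamma0 a l = 1 := mul_eq_one_comm.1 (gamma0_mul_inv ha l)
  have h1 : expN 0 l = 1 := by simp [expN, Matrix.one_fin_two]
  have := frame_rotate ha (-1) l z
  simpa [h0, h1] using this

lemma isTwisted_winv : IsTwisted winv := by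
  rw [isTwisted_iff]
  intro l
  rw [dEps_conj]
  simp [winv]

lemma isTwisted_gamma0 (a : ℝ) : IsTwisted (gamma0 a) := by
  rw [isTwisted_iff]
  exact fun l => gamma0_rotate a (-1) l

lemma Good.facF_twisted (h : Good a z) (ha : 0 < a) : IsTwisted (facF a z) :=
  ((isTwisted_frame ha z).mul h.facB_twisted.adjugate).mul isTwisted_winv

/-! ### Smoothness -/

lemma IsSmoothFamily.mul {U : Set ℂ} {G K : ℂ → Circle → Mat2} (hG : IsSmoothFamily U G)
    (hK : IsSmoothFamily U K) : IsSmoothFamily U fun z l => G z l * K z l := by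
  intro i j
  simp only [Matrix.mul_apply, Fin.sum_univ_two]
  exact ((hG _ _).mul (hK _ _)).add ((hG _ _).mul (hK _ _))

lemma IsSmoothFamily.adjugate {U : Set ℂ} {G : ℂ → Circle → Mat2} (hG : IsSmoothFamily U G) :
    IsSmoothFamily U fun z l => (G z l).adjugate := by
  intro i j
  simp only [Matrix.adjugate_fin_two]
  fin_cases i <;> fin_cases j
  · exact hG 1 1
  · exact (hG 0 1).neg
  · exact (hG 1 0).neg
  · exact hG 0 0

lemma isSmoothFamily_of {U : Set ℂ} {p q r s : ℂ → Circle → ℂ}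
    (hp : ContDiffOn ℝ ∞ (fun x : ℂ × ℝ => p x.1 (Circle.exp x.2)) (U ×ˢ Set.univ))
    (hq : ContDiffOn ℝ ∞ (fun x : ℂ × ℝ => q x.1 (Circle.exp x.2)) (U ×ˢ Set.univ))
    (hr : ContDiffOn ℝ ∞ (fun x : ℂ × ℝ => r x.1 (Circle.exp x.2)) (U ×ˢ Set.univ))
    (hs : ContDiffOn ℝ ∞ (fun x : ℂ × ℝ => s x.1 (Circle.exp x.2)) (U ×ˢ Set.univ)) :
    IsSmoothFamily U fun z l => !![p z l, q z l; r z l, s z l] := by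
  intro i j
  fin_cases i <;> fin_cases j <;> assumption

lemma IsSmoothFamily.loop {U : Set ℂ} {G : ℂ → Circle → Mat2} (hG : IsSmoothFamily U G)
    (hz : z ∈ U) (i j : Fin 2) : ContDiff ℝ ∞ fun θ : ℝ => G z (Circle.exp θ) i j := by
  rw [← contDiffOn_univ]
  exact (hG i j).comp (contDiff_prodMk_right z).contDiffOn fun θ _ => ⟨hz, trivial⟩

section

variable {U : Set ℂ}

lemma contDiff_coe_exp : ContDiff ℝ ∞ fun x : ℂ × ℝ => (Circle.exp x.2 : ℂ) :=
  contDiff_circle_exp.comp contDiff_snd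

lemma contDiff_inv_coe_exp : ContDiff ℝ ∞ fun x : ℂ × ℝ => (Circle.exp x.2 : ℂ)⁻¹ :=
  contDiff_coe_exp.inv fun _ => Circle.coe_ne_zero _

lemma isSmoothFamily_winv : IsSmoothFamily U fun _ => winv :=
  isSmoothFamily_of contDiffOn_const contDiff_coe_exp.neg.contDiffOn
    contDiff_inv_coe_exp.contDiffOn contDiffOn_const

lemma isSmoothFamily_gamma0 : IsSmoothFamily U fun _ => gamma0 a := by
  refine isSmoothFamily_of contDiffOn_const ?_ contDiffOn_const contDiffOn_const
  simp only [div_eq_mul_inv]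
  exact (contDiff_coe_exp.neg.mul contDiff_const).contDiffOn

lemma isSmoothFamily_gamma0_inv (ha : 0 < a) : IsSmoothFamily U fun _ l => (gamma0 a l)⁻¹ := by
  simp only [gamma0_inv ha, div_eq_mul_inv]
  exact isSmoothFamily_of contDiffOn_const (contDiff_coe_exp.mul contDiff_const).contDiffOn
    contDiffOn_const contDiffOn_const

lemma isSmoothFamily_expN_log (hU : U ⊆ Complex.slitPlane) :
    IsSmoothFamily U fun z => expN (Complex.log z) := by
  refine isSmoothFamily_of contDiffOn_const contDiffOn_const ?_ contDiffOn_const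
  simp only [div_eq_mul_inv]
  refine ContDiffOn.mul (fun x hx => ?_) contDiff_inv_coe_exp.contDiffOn
  exact (((Complex.contDiffAt_log (hU hx.1)).restrict_scalars ℝ).comp x
    contDiffAt_fst).contDiffWithinAt

lemma isSmoothFamily_L0 : IsSmoothFamily U fun z l => L0 z l := by
  have hx : ContDiff ℝ ∞ fun x : ℂ × ℝ => x.1 / (Circle.exp x.2 : ℂ) ^ 2 := by
    simp only [div_eq_mul_inv, ← inv_pow]
    exact contDiff_fst.mul (contDiff_inv_coe_exp.pow 2)
  have hc : ∀ {g : ℂ → ℂ}, Differentiable ℂ g →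
      ContDiff ℝ ∞ fun x : ℂ × ℝ => g (x.1 / (Circle.exp x.2 : ℂ) ^ 2) := fun hg =>
    ((hg.contDiff (n := ∞)).restrict_scalars ℝ).comp hx
  have h0 := hc differentiable_g0
  have h1 := hc differentiable_g1
  have h2 := hc differentiable_u0
  have h3 := hc differentiable_u1
  have he : (fun (z : ℂ) (l : Circle) => L0 z l) = fun (z : ℂ) (l : Circle) =>
      !![g0 (z / (l : ℂ) ^ 2), l * u0 (z / (l : ℂ) ^ 2);
       -(2 * (l : ℂ)⁻¹) * g1 (z / (l : ℂ) ^ 2), g0 (z / (l : ℂ) ^ 2) - 2 * u1 (z / (l : ℂ) ^ 2)] := by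
    funext z l
    rw [L0_eq z l l.coe_ne_zero, div_eq_mul_inv 2]
  rw [he]
  exact isSmoothFamily_of h0.contDiffOn (contDiff_coe_exp.mul h2).contDiffOn
    ((contDiff_const.mul contDiff_inv_coe_exp).neg.mul h1).contDiffOn
    (h0.sub (contDiff_const.mul h3)).contDiffOn

lemma isSmoothFamily_frame (ha : 0 < a) (hU : U ⊆ Complex.slitPlane) :
    IsSmoothFamily U (frame a) := by
  have : frame a = fun z l => (gamma0 a l)⁻¹ * expN (Complex.log z) l * L0 z l := by
    funext z l
    exact frame_eq a z l
  rw [this]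
  exact ((isSmoothFamily_gamma0_inv ha).mul (isSmoothFamily_expN_log hU)).mul isSmoothFamily_L0

lemma contDiffOn_sqrt_comp {f : ℂ → ℝ} (hf : ∀ z ∈ U, ContDiffAt ℝ ∞ f z ∧ 0 < f z) :
    ContDiffOn ℝ ∞ (fun x : ℂ × ℝ => (√(f x.1) : ℂ)) (U ×ˢ Set.univ) ∧
    ContDiffOn ℝ ∞ (fun x : ℂ × ℝ => (√(f x.1) : ℂ)⁻¹) (U ×ˢ Set.univ) := by
  have h : ContDiffOn ℝ ∞ (fun x : ℂ × ℝ => (√(f x.1) : ℂ)) (U ×ˢ Set.univ) := fun x hx =>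
    (Complex.ofRealCLM.contDiff.contDiffAt.comp x
      (((hf x.1 hx.1).1.sqrt (hf x.1 hx.1).2.ne').comp x contDiffAt_fst)).contDiffWithinAt
  exact ⟨h, h.inv fun x hx => sqrt_ofReal_ne_zero (hf x.1 hx.1).2⟩

lemma isSmoothFamily_facB (hU : ∀ z ∈ U, Good a z) : IsSmoothFamily U fun z l => facB a z l := by
  have hp : ∀ z ∈ U, ContDiffAt ℝ ∞ (pVal a) z ∧ 0 < pVal a z := by
    intro z hz
    have h := hU z hz
    refine ⟨?_, h.sol_pos⟩
    have h1 := contDiffAt_solP a h.slit h.sVal_pos h.isUnit (m := 0) (by simp) 0 0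
    exact Complex.reCLM.contDiff.contDiffAt.comp z
      (h1.comp z ((contDiff_prodMk_left (0 : ℂ)).contDiffAt))
  obtain ⟨p1, p2⟩ := contDiffOn_sqrt_comp hp
  obtain ⟨s1, s2⟩ := contDiffOn_sqrt_comp (f := sVal a) fun z hz =>
    ⟨contDiffAt_sVal a (hU z hz).slit, (hU z hz).sVal_pos⟩
  have hP : IsSmoothFamily U fun z l => solP a z l := by
    rintro i j ⟨z, θ⟩ hx
    have h := hU z hx.1
    exact ((contDiffAt_solP a h.slit h.sVal_pos h.isUnit (circle_mem_ball (Circle.exp θ)) i j).comp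
      (z, θ) (contDiff_fst.prodMk contDiff_coe_exp).contDiffAt).contDiffWithinAt
  have hB : IsSmoothFamily U fun z l => leadB (sVal a z) l := by
    refine isSmoothFamily_of s1 ?_ contDiffOn_const s2
    simp only [div_eq_mul_inv]
    exact contDiff_coe_exp.neg.contDiffOn.mul s2
  exact ((isSmoothFamily_of p1 contDiffOn_const contDiffOn_const p2).mul hP.adjugate).mul hB

end

lemma isIwasawaFactorization {U : Set ℂ} (ha : 0 < a) (hU : ∀ z ∈ U, Good a z) :
    IsIwasawaFactorization U (fun z l => (gamma0 a l)⁻¹ * L z l) (facF a) w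
      (fun z l => facB a z l) := by
  have hB := isSmoothFamily_facB hU
  have hF : IsSmoothFamily U (facF a) :=
    ((isSmoothFamily_frame ha fun z hz => (hU z hz).slit).mul hB.adjugate).mul isSmoothFamily_winv
  refine ⟨hF, hB, fun z hz => ?_, fun z hz => ?_, fun z hz l => ?_⟩
  · have h := hU z hz
    exact ⟨⟨⟨hF.loop hz, h.det_facF ha⟩, h.facF_twisted ha⟩, h.facF_mem_SU11 ha⟩
  · have h := hU z hz
    exact ⟨⟨⟨hB.loop hz, fun l => h.det_facB l (circle_mem_closedBall l)⟩, h.facB_twisted⟩,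
      facB a z, h.isDiskExtension⟩
  · rw [facF_mul_w, Matrix.mul_assoc, (hU z hz).adjugate_mul_facB, Matrix.mul_one, frame]

lemma gamma0_mem (ha : 0 < a) : gamma0 a ∈ TwistedLoopSL := by
  refine ⟨⟨(isSmoothFamily_gamma0 (U := Set.univ)).loop (Set.mem_univ 0), det_gamma0 ha⟩,
    isTwisted_gamma0 a⟩

end Frame

section Main

open Matrix Filter

variable {a : ℝ} {U : Set ℂ}

/-- `G⁻¹ dG` is invariant under left multiplication by a constant and equivariant under conjugation
and linear change of variables. -/
lemma maurerCartan_of_eventuallyEq {G : ℂ → Circle → Mat2} {c z : ℂ} {l m : Circle} {J d : Mat2}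
    (hG : ∀ i j, DifferentiableAt ℝ (fun x => G x l i j) z)
    (hG' : ∀ i j, DifferentiableAt ℝ (fun x => G x m i j) (c * z))
    (hJ : IsUnit J.det) (h : ∀ᶠ x in 𝓝 z, G (c * x) m = J * G x l * d) (v : ℂ) :
    maurerCartan G (c * z) m (c * v) = d⁻¹ * maurerCartan G z l v * d := by
  set A : Mat2 := Matrix.of fun i j => fderiv ℝ (fun x => G x l i j) z v with hA
  have key : (Matrix.of fun i j => fderiv ℝ (fun x => G x m i j) (c * z) (c * v)) = J * A * d := by
    ext i j
    have h1 : HasFDerivAt (fun x => G (c * x) m i j)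
        ((fderiv ℝ (fun x => G x m i j) (c * z)).comp (ContinuousLinearMap.mul ℝ ℂ c)) z :=
      (hG' i j).hasFDerivAt.comp z (ContinuousLinearMap.mul ℝ ℂ c).hasFDerivAt
    have h2 : HasFDerivAt (fun x => G (c * x) m i j)
        (∑ q, d q j • ∑ p, J i p • fderiv ℝ (fun x => G x l p q) z) z := by
      have h3 : HasFDerivAt (fun x => ∑ q, (∑ p, J i p * G x l p q) * d q j)
          (∑ q, d q j • ∑ p, J i p • fderiv ℝ (fun x => G x l p q) z) z :=
        HasFDerivAt.fun_sum fun q _ => HasFDerivAt.mul_const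
          (HasFDerivAt.fun_sum fun p _ => (hG p q).hasFDerivAt.const_mul (J i p)) (d q j)
      refine h3.congr_of_eventuallyEq ?_
      filter_upwards [h] with x hx
      rw [hx]
      simp only [Matrix.mul_apply]
    have h4 := DFunLike.congr_fun (h1.unique h2) v
    simp only [ContinuousLinearMap.comp_apply, ContinuousLinearMap.mul_apply'] at h4
    rw [Matrix.of_apply, h4]
    simp [Matrix.mul_apply, hA]
    ring
  rw [maurerCartan, maurerCartan, key, h.self_of_nhds, ← hA, Matrix.mul_inv_rev, Matrix.mul_inv_rev]
  calc _ = d⁻¹ * (G z l)⁻¹ * (J⁻¹ * J) * A * d := by simp only [Matrix.mul_assoc]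
    _ = _ := by rw [Matrix.nonsing_inv_mul _ hJ]; simp only [Matrix.mul_assoc, Matrix.one_mul]

lemma eventually_log_sub_const {c z : ℂ} (hz : z ∈ Complex.slitPlane) (hcz : c * z ∈ Complex.slitPlane) :
    ∀ᶠ x in 𝓝 z, Complex.log (c * x) - Complex.log x = Complex.log (c * z) - Complex.log z := by
  have hS : ∀ᶠ x in 𝓝 z, x ∈ Complex.slitPlane ∧ c * x ∈ Complex.slitPlane := by
    refine Filter.Eventually.and (Complex.isOpen_slitPlane.mem_nhds hz) ?_
    exact (continuous_const_mul c).continuousAt.eventually (Complex.isOpen_slitPlane.mem_nhds hcz)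
  obtain ⟨r, hr, hb⟩ := Metric.eventually_nhds_iff_ball.1 hS
  have hd : ∀ x ∈ Metric.ball z r,
      HasDerivAt (fun x => Complex.log (c * x) - Complex.log x) 0 x := by
    intro x hx
    obtain ⟨h1, h2⟩ := hb x hx
    have hc : c * x ≠ 0 := Complex.slitPlane_ne_zero h2
    have e1 := ((hasDerivAt_id x).const_mul c).clog h2
    refine (e1.sub (Complex.hasDerivAt_log h1)).congr_deriv ?_
    have hc0 := left_ne_zero_of_mul hc
    have hx0 := right_ne_zero_of_mul hc
    simp only [id]
    field_simp
    simp
  filter_upwards [Metric.ball_mem_nhds z hr] with x hx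
  exact Metric.isOpen_ball.is_const_of_deriv_eq_zero (convex_ball z r).isPreconnected
    (fun y hy => (hd y hy).differentiableAt.differentiableWithinAt)
    (fun y hy => (hd y hy).deriv) hx (Metric.mem_ball_self hr)

lemma maurerCartan_facF_rotate (ha : 0 < a) (hUo : IsOpen U) (hU : ∀ z ∈ U, Good a z) {z : ℂ}
    (ε l : Circle) (v : ℂ) (hz : z ∈ U) (hz' : (ε : ℂ) ^ 2 * z ∈ U) :
    maurerCartan (fun z l => facF a z l * w l) ((ε : ℂ) ^ 2 * z) (ε * l) ((ε : ℂ) ^ 2 * v) =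
      (dEps ε)⁻¹ * maurerCartan (fun z l => facF a z l * w l) z l v * dEps ε := by
  have hsm : IsSmoothFamily U fun z l => facF a z l * w l := by
    simp only [facF_mul_w]
    exact (isSmoothFamily_frame ha fun z hz => (hU z hz).slit).mul (isSmoothFamily_facB hU).adjugate
  have hdiff : ∀ (x : ℂ) (l : Circle), x ∈ U → ∀ i j,
      DifferentiableAt ℝ (fun x => (facF a x l * w l) i j) x := by
    intro x l hx i j
    obtain ⟨θ, rfl⟩ : ∃ θ, Circle.exp θ = l := ⟨_, Circle.exp_arg l⟩
    have h1 := (hsm i j).comp (contDiff_prodMk_left θ).contDiffOn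
      (fun y (hy : y ∈ U) => (⟨hy, trivial⟩ : (y, θ) ∈ U ×ˢ Set.univ))
    exact (h1.contDiffAt (hUo.mem_nhds hx)).differentiableAt (by simp)
  refine maurerCartan_of_eventuallyEq (J := (dEps ε)ᴴ * ((gamma0 a l)⁻¹ *
      expN (Complex.log ((ε : ℂ) ^ 2 * z) - Complex.log z) l * gamma0 a l)) (hdiff z l hz)
    (hdiff _ _ hz') ?_ ?_ v
  · have h1 : ∀ t, (expN t l).det = 1 := fun t => by simp [expN]
    have h2 : (dEps ε)ᴴ.det ≠ 0 := by
      rw [dEps_conjTranspose]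
      simp
    rw [det_mul, det_mul, det_mul, h1, det_gamma0 ha, det_gamma0_inv ha]
    simpa using h2
  · have e1 := eventually_log_sub_const (hU z hz).slit (hU _ hz').slit
    have e2 := (continuous_const_mul ((ε : ℂ) ^ 2)).continuousAt.eventually (hUo.mem_nhds hz')
    filter_upwards [e1, e2, hUo.mem_nhds hz] with x h1 h2 h3
    rw [facF_mul_w, facF_mul_w, frame_rotate ha, facB_rotate (hU x h3) (hU _ h2),
      dEps_conj_adjugate, h1]
    calc _ = (dEps ε)ᴴ * ((gamma0 a l)⁻¹ *
          expN (Complex.log ((ε : ℂ) ^ 2 * z) - Complex.log z) l * gamma0 a l) * frame a x l *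
          (dEps ε * (dEps ε)ᴴ) * (facB a x l).adjugate * dEps ε := by simp only [Matrix.mul_assoc]
      _ = _ := by
          rw [dEps_mul_conjTranspose, Matrix.mul_one]
          simp only [Matrix.mul_assoc]

lemma exists_radius_good (a : ℝ) :
    ∃ r > 0, ∀ z ∈ Metric.ball (0 : ℂ) r ∩ Complex.slitPlane, Good a z := by
  have h1 := (tendsto_sVal a).eventually_gt_atTop 0
  have h2 := eventually_isUnit_opT a
  have h3 := (tendsto_solP_zero a).eventually (lt_mem_nhds one_pos)
  obtain ⟨r, hr, hsub⟩ := Metric.mem_nhdsWithin_iff.1 (h1.and (h2.and h3))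
  refine ⟨r, hr, fun z hz => ?_⟩
  obtain ⟨k1, k2, k3⟩ := hsub ⟨hz.1, Complex.slitPlane_ne_zero hz.2⟩
  exact ⟨hz.2, k1, k2, k3⟩

lemma isConnected_ball_inter_slitPlane {r : ℝ} (hr : 0 < r) :
    IsConnected (Metric.ball (0 : ℂ) r ∩ Complex.slitPlane) := by
  have hr2 : 0 < r / 2 := half_pos hr
  have h1 : ((r / 2 : ℝ) : ℂ) ∈ Metric.ball (0 : ℂ) r := by
    rw [mem_ball_zero_iff, Complex.norm_real, Real.norm_of_nonneg hr2.le]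
    linarith
  have h2 : ((r / 2 : ℝ) : ℂ) ∈ Complex.slitPlane := Complex.ofReal_mem_slitPlane.2 hr2
  exact (StarConvex.isPathConnected (((convex_ball 0 r).starConvex h1).inter
    (Complex.starConvex_ofReal_slitPlane hr2)) ⟨h1, h2⟩).isConnected

end Main

end CP1

theorem mainTheorem1 (a : ℝ) (ha : 0 < a) :
    CP1.gamma0 a ∈ CP1.TwistedLoopSL ∧
    ∃ V U : Set ℂ, IsOpen V ∧ (0 : ℂ) ∈ V ∧ U = V ∩ Complex.slitPlane ∧ IsConnected U ∧
    ∃ F B : ℂ → Circle → CP1.Mat2,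
      -- (a) Iwasawa factorization
      CP1.IsIwasawaFactorization U (fun z l => (CP1.gamma0 a l)⁻¹ * CP1.L z l) F CP1.w B ∧
      -- (b) homogeneity of the factor B, and of the 1-form α = (Fw)⁻¹ d(Fw)
      (∀ (ε l : Circle) (z : ℂ), z ∈ U → (ε : ℂ) ^ 2 * z ∈ U →
        B ((ε : ℂ) ^ 2 * z) (ε * l) = (CP1.dEps ε)⁻¹ * B z l * CP1.dEps ε) ∧
      (∀ (ε l : Circle) (z v : ℂ), z ∈ U → (ε : ℂ) ^ 2 * z ∈ U →
        CP1.maurerCartan (fun z l => F z l * CP1.w l) ((ε : ℂ) ^ 2 * z) (ε * l) ((ε : ℂ) ^ 2 * v) =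
          (CP1.dEps ε)⁻¹ * CP1.maurerCartan (fun z l => F z l * CP1.w l) z l v * CP1.dEps ε) ∧
      -- (c) the leading term of B
      ∃ k g : ℂ → ℝ,
        (∀ z ∈ U, 0 < k z ∧
          CP1.HasLeadingTerm (B z) !![(k z : ℂ), 0; 0, (k z : ℂ)⁻¹] ∧
          k z = √(-a - 2 * (Complex.log z).re) * g z) ∧
        Filter.Tendsto g (𝓝[U] 0) (𝓝 1) := by
  obtain ⟨r, hr, hgood⟩ := CP1.exists_radius_good a
  refine ⟨CP1.gamma0_mem ha, Metric.ball 0 r, _, Metric.isOpen_ball, Metric.mem_ball_self hr, rfl,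
    CP1.isConnected_ball_inter_slitPlane hr, CP1.facF a, fun z l => CP1.facB a z l,
    CP1.isIwasawaFactorization ha hgood, fun ε l z hz hz' => ?_, fun ε l z v hz hz' => ?_,
    fun z => √(CP1.sVal a z) * (√(CP1.pVal a z))⁻¹, fun z => (√(CP1.pVal a z))⁻¹,
    fun z hz => ⟨?_, (hgood z hz).hasLeadingTerm, rfl⟩, ?_⟩
  · rw [CP1.dEps_inv]
    exact CP1.facB_rotate (hgood z hz) (hgood _ hz') l
  · exact CP1.maurerCartan_facF_rotate ha (Metric.isOpen_ball.inter Complex.isOpen_slitPlane) hgood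
      ε l v hz hz'
  · exact mul_pos (Real.sqrt_pos.2 (hgood z hz).sVal_pos)
      (inv_pos.2 (Real.sqrt_pos.2 (hgood z hz).sol_pos))
  · have h := ((CP1.tendsto_solP_zero a).sqrt.inv₀ (by simp)).mono_left (nhdsWithin_mono 0
      fun z (hz : z ∈ Metric.ball (0 : ℂ) r ∩ Complex.slitPlane) => Complex.slitPlane_ne_zero hz.2)
    rw [Real.sqrt_one, inv_one] at h
    exact h
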